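/- Let $p$ be an odd prime, $n\ge 1$, and let $G=\mathrm{Hol}(C_{p^n})=C_{p^n}\rtimes \mathrm{Aut}(C_{p^n})$ be the holomorph of the cyclic group of order $p^n$. Let $r$ be an integer of multiplicative order $p^{n-1}(p-1)$ modulo $p^n$, let $\phi$ be Euler's function, and let $\zeta\in\mathbb C$ be a primitive $p^n$-th root of unity. Then $G$ has the presentation $$G=\langle a,b \mid a^{p^n}=1,\ b^{p^{n-1}(p-1)}=1,\ b^{-1}ab=a^r\rangle ,$$ and for any generators $a,b$ of $G$ giving such a presentation the following hold. The subgroup $N=\langle a\rangle$ is normal; for $i\ge 0$ let $\chi_i$ be the linear character of $N$ with $\chi_i(a)=\zeta^i$, and for $0\le k\le n$ let $\mathcal O_k$ be the orbit of $\chi_{p^{n-k}}$ under the action $\chi^g(x)=\chi(g^{-1}xg)$ of $G$. An irreducible complex representation of $G$ is said to correspond to $\mathcal O_k$ if, for some $\chi\in\mathcal O_k$ with stabiliser $I_\chi$ in $G$ and some irreducible representation $\sigma$ of $H_\chi=I_\chi\cap\langle b\rangle$, it is equivalent to the representation induced from the representation $\chi\otimes\sigma\colon xh\mapsto\chi(x)\sigma(h)$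 ($x\in N$, $h\in H_\chi$) of $I_\chi$. Representations are counted up to equivalence. 1. $G$ has exactly $\phi(p^n)$ complex representations of degree $1$; they are the pairwise inequivalent $\rho_{0,\omega}$ with $\rho_{0,\omega}(a)=1$, $\rho_{0,\omega}(b)=\omega$, where $\omega$ runs over the $p^{n-1}(p-1)$-th roots of unity. 2. For $1\le k\le n$, exactly $p^{n-k}$ irreducible complex representations of $G$ correspond to $\mathcal O_k$; these are exactly the irreducible complex representations of degree $\phi(p^k)$, and they are the pairwise inequivalent $\rho_{k,\omega}$, where $\omega$ runs over the $p^{n-k}$-th roots of unity and, with $d=\phi(p^k)$, $$\rho_{k,\omega}(a)=\mathrm{diag}\bigl(\zeta^{p^{n-k}},\zeta^{rp^{n-k}},\dots,\zeta^{r^{d-1}p^{n-k}}\bigr),\qquad \rho_{k,\omega}(b)=\begin{bmatrix}0&0&\cdots&0&\omega\\1&0&\cdots&0&0\\0&1&\cdots&0&0\\ \vdots&&\ddots&&\vdots\\0&0&\cdots&1&0\end{bmatrix}.$$ 3. $G$ has exactly $(1+p+\cdots+p^n)-p^{n-1}$ inequivalent irreducible complex representations. 4. Exactly one irreducible complex representation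 of $G$ corresponds to $\mathcal O_n$; it has degree $\phi(p^n)$, and it is the unique faithful irreducible complex representation of $G$. -/

import Mathlib

/-- The holomorph of a group `C`: the semidirect product of `C` with its automorphism group,
for the natural action. -/
abbrev Holomorph (C : Type*) [Group C] : Type _ :=
  C ⋊[MonoidHom.id (MulAut C)] MulAut C

/-- The relators of `⟨a, b | a ^ (p ^ n) = b ^ (p ^ (n - 1) * (p - 1)) = 1, b⁻¹ * a * b = a ^ r⟩`,
where `a`, `b` are the generators with index `0`, `1`. -/
def holRels (p n : ℕ) (r : ℤ) : Set (FreeGroup (Fin 2)) :=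
  {FreeGroup.of 0 ^ (p ^ n),
   FreeGroup.of 1 ^ (p ^ (n - 1) * (p - 1)),
   (FreeGroup.of 1)⁻¹ * FreeGroup.of 0 * FreeGroup.of 1 * (FreeGroup.of 0 ^ r)⁻¹}

/-- An irreducible complex representation of `G` of degree `dim`, on the space `ℂ ^ dim`. -/
structure CIrrep (G : Type*) [Group G] where
  dim : ℕ
  rep : Representation ℂ G (Fin dim → ℂ)
  irred : rep.IsIrreducible

/-- Equivalence of irreducible complex representations. -/
instance CIrrep.setoid (G : Type*) [Group G] : Setoid (CIrrep G) where
  r R S := Nonempty (R.rep.Equiv S.rep)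
  iseqv :=
    { refl := fun R => ⟨Representation.Equiv.refl R.rep⟩
      symm := fun ⟨e⟩ => ⟨e.symm⟩
      trans := fun ⟨e⟩ ⟨f⟩ => ⟨e.trans f⟩ }

/-- The set of equivalence classes of irreducible complex representations of `G`. -/
def Irr (G : Type*) [Group G] : Type _ := Quotient (CIrrep.setoid G)

/-- The class of an irreducible representation on `ℂ ^ d`. -/
def Irr.mk {G : Type*} [Group G] {d : ℕ} (R : Representation ℂ G (Fin d → ℂ))
    (hR : R.IsIrreducible) : Irr G :=
  Quotient.mk (CIrrep.setoid G) ⟨d, R, hR⟩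

/-- The class `c` has degree `d`. -/
def Irr.HasDegree {G : Type*} [Group G] (c : Irr G) (d : ℕ) : Prop :=
  ∃ (R : Representation ℂ G (Fin d → ℂ)) (hR : R.IsIrreducible), Irr.mk R hR = c

/-- The class `c` consists of faithful representations. -/
def Irr.IsFaithful {G : Type*} [Group G] (c : Irr G) : Prop :=
  ∃ (d : ℕ) (R : Representation ℂ G (Fin d → ℂ)) (hR : R.IsIrreducible),
    Irr.mk R hR = c ∧ Function.Injective R

/-- The conjugate `χ ^ g` of a linear character of a normal subgroup:
`χ ^ g (x) = χ (g⁻¹ * x * g)`. -/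
def conjChar {G : Type*} [Group G] {N : Subgroup G} [N.Normal] (χ : N →* ℂˣ) (g : G) :
    N →* ℂˣ :=
  χ.comp (MulAut.conjNormal g⁻¹).toMonoidHom

/-- The orbit of `χ` under conjugation by `G`. -/
def charOrbit {G : Type*} [Group G] {N : Subgroup G} [N.Normal] (χ : N →* ℂˣ) :
    Set (N →* ℂˣ) :=
  Set.range (conjChar χ)

theorem conjChar_one {G : Type*} [Group G] {N : Subgroup G} [N.Normal] (χ : N →* ℂˣ) :
    conjChar χ 1 = χ := by
  ext x; simp [conjChar]

theorem conjChar_mul {G : Type*} [Group G] {N : Subgroup G} [N.Normal] (χ : N →* ℂˣ) (g h : G) :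
    conjChar χ (g * h) = conjChar (conjChar χ h) g := by
  ext x; simp [conjChar]

/-- The stabiliser `I_χ` of `χ` in `G`. -/
def inertiaGroup {G : Type*} [Group G] {N : Subgroup G} [N.Normal] (χ : N →* ℂˣ) :
    Subgroup G where
  carrier := {g | conjChar χ g = χ}
  one_mem' := conjChar_one χ
  mul_mem' := by
    intro g h hg hh
    simp only [Set.mem_ofPred_eq] at hg hh ⊢
    rw [conjChar_mul, hh, hg]
  inv_mem' := by
    intro g hg
    simp only [Set.mem_ofPred_eq] at hg ⊢
    conv_lhs => rw [← hg]
    rw [← conjChar_mul, inv_mul_cancel, conjChar_one]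

/-- For `G` the semidirect product of an abelian normal subgroup `N` by `H`, the irreducible
representations attached by the method of little groups to an orbit `O` of linear characters of
`N`: those induced from `χ ⊗ σ` on the stabiliser `I_χ`, where `χ ∈ O`, where `χ` is extended to
`I_χ` trivially on `H_χ = I_χ ∩ H`, and where `σ` is an irreducible representation of `H_χ`.
The representation `τ = χ ⊗ σ` is the one that acts on `N` through the scalars `χ` and whose
restriction to `H_χ` is the irreducible representation `σ`. -/
def Irr.Corresponds {G : Type*} [Group G] {N : Subgroup G} [N.Normal] (H : Subgroup G)
    (O : Set (N →* ℂˣ)) (c : Irr G) : Prop :=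
  ∃ χ ∈ O, ∃ (d : ℕ) (τ : Representation ℂ (inertiaGroup χ) (Fin d → ℂ)),
    (∀ (g : inertiaGroup χ) (hg : (g : G) ∈ N), τ g = ((χ ⟨g, hg⟩ : ℂˣ) : ℂ) • LinearMap.id) ∧
    Representation.IsIrreducible
      (τ.comp (H.subgroupOf (inertiaGroup χ)).subtype :
        Representation ℂ (H.subgroupOf (inertiaGroup χ)) (Fin d → ℂ)) ∧
    ∃ (m : ℕ) (R : Representation ℂ G (Fin m → ℂ)) (hR : R.IsIrreducible),
      Irr.mk R hR = c ∧
        Nonempty (R.Equiv (Representation.ind (inertiaGroup χ).subtype τ))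

/-- The diagonal matrix with entries `ζ ^ (r ^ j * m)`, `0 ≤ j < d`. -/
noncomputable def matA (d : ℕ) (ζ : ℂ) (r : ℤ) (m : ℕ) : Matrix (Fin d) (Fin d) ℂ :=
  Matrix.diagonal fun j => ζ ^ (r ^ (j : ℕ) * (m : ℤ))

/-- The matrix with entries `1` just below the diagonal, `ω` in the upper right corner, and `0`
elsewhere. -/
noncomputable def matB (d : ℕ) (ω : ℂ) : Matrix (Fin d) (Fin d) ℂ :=
  Matrix.of fun i j =>
    if (i : ℕ) = (j : ℕ) + 1 then 1
    else if (i : ℕ) = 0 ∧ (j : ℕ) + 1 = d then ω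
    else 0

/-! Everything rests on following an eigenvector of `a`. Since `a * b = b * a ^ r`, applying `b` to
a `μ`-eigenvector of `a` gives a `μ ^ r`-eigenvector. In an irreducible `V` an eigenvalue of `a` is
a primitive `p ^ k`-th root of unity for some `k ≤ n`, and `r` generates the units modulo `p ^ k`,
so powers of `b` move it to `μ = ζ ^ p ^ (n - k)`. With `d = φ(p ^ k)`, the element `b ^ d`
preserves the `μ`-eigenspace and has there an eigenvector `v` of eigenvalue `ω`. The shift
representation is universal for such data (`IsShiftRep.exists_intertwiningMap`). It is irreducible
because the `d` eigenvalues of `a` are distinct, so Schur's lemma identifies it with `V`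
(`HolSetup.exists_equiv_of_eigenvector`).

The parameters are invariants: `b ^ d` acts as the scalar `ω`, and the degree `φ(p ^ k)` determines
`k` as `p` is odd. The relation on `b` makes `ω` an `E`-th root of unity, where `d * E = p ^ (n - 1)
* (p - 1)`; conversely every such `ω` occurs, since the matrices satisfy the relators. This gives
the counts.

For the little groups no dimension of an induced module is computed. An induced representation
attached to the orbit contains the eigenvalue `μ`, which fixes its degree. Conversely, the first
basis line of a shift representation is stable under the stabiliser, and the universal property maps
the shift representation isomorphically onto the representation induced from that line. -/

/-! ### Weighted cyclic shifts on the standard basis -/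

section ShiftMatrices

theorem matA_single (d : ℕ) (ζ : ℂ) (r : ℤ) (m : ℕ) (j : Fin d) :
    Matrix.toLin' (matA d ζ r m) (Pi.single j 1) = (ζ ^ m) ^ (r ^ (j : ℕ)) • Pi.single j 1 := by
  ext i
  have h : (ζ ^ m) ^ (r ^ (j : ℕ)) = ζ ^ (r ^ (j : ℕ) * (m : ℤ)) := by
    rw [mul_comm, zpow_mul, zpow_natCast]
  rw [h]
  by_cases hij : i = j
  · subst hij; simp [matA, Matrix.mulVec_diagonal]
  · simp [matA, Matrix.mulVec_diagonal, hij]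

theorem matB_single_succ (d : ℕ) (ω : ℂ) (j : ℕ) (h : j + 1 < d) :
    Matrix.toLin' (matB d ω) (Pi.single ⟨j, by omega⟩ 1) = Pi.single ⟨j + 1, h⟩ 1 := by
  ext i
  simp only [Matrix.toLin'_apply, Matrix.mulVec_single_one, Matrix.col_apply, matB,
    Matrix.of_apply, Pi.single_apply, Fin.ext_iff]
  have : ¬ (j + 1 = d) := by omega
  simp [this]

theorem matB_single_last (d : ℕ) (ω : ℂ) (hd : 0 < d) :
    Matrix.toLin' (matB d ω) (Pi.single ⟨d - 1, by omega⟩ 1) = ω • Pi.single ⟨0, hd⟩ 1 := by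
  ext i
  have h1 : ¬ ((i : ℕ) = d - 1 + 1) := by omega
  have h2 : d - 1 + 1 = d := by omega
  simp only [Matrix.toLin'_apply, Matrix.mulVec_single_one, Matrix.col_apply, matB,
    Matrix.of_apply, Pi.smul_apply, Pi.single_apply, Fin.ext_iff]
  rw [if_neg h1]
  simp [h2]

theorem matB_pow_single_zero (d : ℕ) (ω : ℂ) (hd : 0 < d) (j : ℕ) (hj : j < d) :
    (Matrix.toLin' (matB d ω) ^ j) (Pi.single ⟨0, hd⟩ 1) = Pi.single ⟨j, hj⟩ 1 := by
  induction j with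
  | zero => simp
  | succ j ih =>
    rw [pow_succ', Module.End.mul_apply, ih (by omega), matB_single_succ]

/-- Going once round the cycle multiplies the first basis vector by `ω`. The other basis vectors are
its images under powers of the shift, which commute with the `d`-th power. -/
theorem matB_pow_degree (d : ℕ) (ω : ℂ) (hd : 0 < d) :
    Matrix.toLin' (matB d ω) ^ d = ω • (1 : Module.End ℂ (Fin d → ℂ)) := by
  have h0 : (Matrix.toLin' (matB d ω) ^ d) (Pi.single ⟨0, hd⟩ 1) = ω • Pi.single ⟨0, hd⟩ 1 := by
    have hpow : Matrix.toLin' (matB d ω) ^ d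
        = Matrix.toLin' (matB d ω) * Matrix.toLin' (matB d ω) ^ (d - 1) := by
      rw [← pow_succ', Nat.sub_add_cancel hd]
    rw [hpow, Module.End.mul_apply]
    have h := matB_pow_single_zero d ω hd (d - 1) (by omega)
    rw [h]
    exact matB_single_last d ω hd
  refine LinearMap.pi_ext' fun j => LinearMap.ext_ring ?_
  obtain ⟨j, hj⟩ := j
  simp only [LinearMap.comp_apply, LinearMap.single_apply, LinearMap.smul_apply,
    Module.End.one_apply]
  rw [← matB_pow_single_zero d ω hd j hj, ← Module.End.mul_apply, ← pow_add, add_comm, pow_add,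
    Module.End.mul_apply, h0, map_smul]

end ShiftMatrices

/-! ### Eigenvectors of `a` and general facts on representations -/

section Eigenvectors

variable {G V : Type*} [Group G] [AddCommGroup V] [Module ℂ V]

theorem Representation.zpow_apply_of_eigenvector (ρ : Representation ℂ G V) {a : G} {μ : ℂ}
    (hμ : μ ≠ 0) {v : V} (h : ρ a v = μ • v) (z : ℤ) : ρ (a ^ z) v = μ ^ z • v := by
  have hinv : ρ a⁻¹ v = μ⁻¹ • v := by
    have h1 : ρ a⁻¹ (ρ a v) = v := by simp
    rw [h, map_smul] at h1
    rw [← h1, smul_smul, h1, inv_mul_cancel₀ hμ, one_smul]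
  induction z with
  | zero => simp
  | succ i ih =>
    rw [zpow_add_one, map_mul, Module.End.mul_apply, h, map_smul, ih, smul_smul,
      zpow_add_one₀ hμ, mul_comm]
  | pred i ih =>
    rw [zpow_sub_one, map_mul, Module.End.mul_apply, hinv, map_smul, ih, smul_smul,
      zpow_sub_one₀ hμ, mul_comm]

theorem Representation.eigenvector_pow_translate (ρ : Representation ℂ G V) {a b : G} {r : ℤ}
    (hab : b⁻¹ * a * b = a ^ r) {μ : ℂ} (hμ : μ ≠ 0) {v : V} (h : ρ a v = μ • v) (j : ℕ) :
    ρ a (ρ (b ^ j) v) = μ ^ (r ^ j) • ρ (b ^ j) v := by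
  induction j with
  | zero => simpa using h
  | succ j ih =>
    have h1 : a * b = b * a ^ r := by rw [← hab]; group
    rw [pow_succ' b, map_mul, Module.End.mul_apply, ← Module.End.mul_apply, ← map_mul, h1, map_mul,
      Module.End.mul_apply, ρ.zpow_apply_of_eigenvector (zpow_ne_zero _ hμ) ih, map_smul,
      ← zpow_mul, ← pow_succ]

theorem Representation.isIrreducible_of_finrank_eq_one (ρ : Representation ℂ G V)
    (h : Module.finrank ℂ V = 1) : ρ.IsIrreducible := by
  have hs : IsSimpleOrder (Submodule ℂ V) := by
    have := isSimpleModule_iff_finrank_eq_one (R := ℂ) (M := V) |>.2 h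
    exact (isSimpleModule_iff ℂ V).1 this
  have hinj := Subrepresentation.toSubmodule_injective (ρ := ρ)
  have : Nontrivial (Subrepresentation ρ) := ⟨⊥, ⊤, fun e => by
    have := congrArg Subrepresentation.toSubmodule e
    exact bot_ne_top (α := Submodule ℂ V) this⟩
  exact ⟨fun W => (hs.eq_bot_or_eq_top W.toSubmodule).imp (fun e => hinj e) (fun e => hinj e)⟩

theorem Representation.IsIrreducible.nontrivial {ρ : Representation ℂ G V}
    (h : ρ.IsIrreducible) : Nontrivial V := by
  by_contra hV
  rw [not_nontrivial_iff_subsingleton] at hV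
  have hinj := Subrepresentation.toSubmodule_injective (ρ := ρ)
  exact bot_ne_top (α := Subrepresentation ρ) (hinj (Subsingleton.elim _ _))

/-- A linear map commuting with the generators is an intertwining map. -/
theorem Representation.comp_eq_of_closure_eq_top {W : Type*} [AddCommGroup W] [Module ℂ W]
    (ρ : Representation ℂ G V) (σ : Representation ℂ G W) {S : Set G}
    (hS : Subgroup.closure S = ⊤) (f : V →ₗ[ℂ] W) (hf : ∀ g ∈ S, f ∘ₗ ρ g = σ g ∘ₗ f) (g : G) :
    f ∘ₗ ρ g = σ g ∘ₗ f := by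
  have hg : g ∈ Subgroup.closure S := hS ▸ Subgroup.mem_top g
  induction hg using Subgroup.closure_induction with
  | mem x hx => exact hf x hx
  | one => ext; simp
  | mul x y _ _ hx hy =>
    ext v
    have h1 := LinearMap.congr_fun hx (ρ y v)
    have h2 := LinearMap.congr_fun hy v
    simp only [LinearMap.comp_apply] at h1 h2
    simp [h1, h2]
  | inv x _ hx =>
    ext v
    have h1 := LinearMap.congr_fun hx (ρ x⁻¹ v)
    simp only [LinearMap.comp_apply, Representation.self_inv_apply] at h1
    simp [h1]

end Eigenvectors

/-! ### Powers of a unit generator acting on primitive roots -/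

section PrimitiveRoots

theorem IsPrimitiveRoot.zpow_eq_zpow_iff {m : ℕ} [NeZero m] {μ : ℂ} (hμ : IsPrimitiveRoot μ m)
    (x y : ℤ) : μ ^ x = μ ^ y ↔ (x : ZMod m) = (y : ZMod m) := by
  have h0 : μ ≠ 0 := hμ.ne_zero (NeZero.ne m)
  rw [ZMod.intCast_eq_intCast_iff_dvd_sub, ← hμ.zpow_eq_one_iff_dvd, zpow_sub₀ h0,
    div_eq_one_iff_eq (zpow_ne_zero _ h0), eq_comm]

/-- An integer generating the units modulo `N` generates the units modulo each divisor of `N`. -/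
theorem exists_unit_generator_of_dvd {N m : ℕ} [NeZero N] (hm : m ∣ N) {r : ℤ}
    (hr : orderOf (r : ZMod N) = N.totient) :
    ∃ u : (ZMod m)ˣ, (u : ZMod m) = (r : ZMod m) ∧ (∀ x, x ∈ Subgroup.zpowers u) ∧
      orderOf u = m.totient := by
  have : NeZero m := ⟨fun h => NeZero.ne N (by simpa [h] using hm)⟩
  have hN : 0 < N.totient := Nat.totient_pos.2 (NeZero.pos N)
  have hpow : (r : ZMod N) ^ N.totient = 1 := by rw [← hr]; exact pow_orderOf_eq_one _
  let w : (ZMod N)ˣ := Units.ofPowEqOne _ _ hpow hN.ne'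
  have hw : (w : ZMod N) = r := rfl
  have hwo : orderOf w = Nat.card (ZMod N)ˣ := by
    rw [← orderOf_units, hw, hr, Nat.card_eq_fintype_card, ZMod.card_units_eq_totient]
  have hwg : ∀ x, x ∈ Subgroup.zpowers w := fun x => by
    have : Subgroup.zpowers w = ⊤ := Subgroup.eq_top_of_card_eq _ (by rw [Nat.card_zpowers, hwo])
    rw [this]; trivial
  -- Units modulo `m` lift to units modulo `N`, so the image of a generator generates.
  have hg : ∀ x, x ∈ Subgroup.zpowers (ZMod.unitsMap hm w) := fun x => by
    obtain ⟨y, rfl⟩ := ZMod.unitsMap_surjective hm x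
    obtain ⟨z, rfl⟩ := hwg y
    exact ⟨z, by simp⟩
  refine ⟨ZMod.unitsMap hm w, ?_, hg, ?_⟩
  · rw [ZMod.unitsMap_def, Units.coe_map, hw]
    simp
  · rw [orderOf_eq_card_of_forall_mem_zpowers hg, Nat.card_eq_fintype_card,
      ZMod.card_units_eq_totient]

variable {N m : ℕ} [NeZero N] {r : ℤ} {μ : ℂ}

theorem IsPrimitiveRoot.zpow_pow_totient (hm : m ∣ N) (hr : orderOf (r : ZMod N) = N.totient)
    (hμ : IsPrimitiveRoot μ m) : μ ^ (r ^ m.totient) = μ := by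
  have : NeZero m := ⟨fun h => NeZero.ne N (by simpa [h] using hm)⟩
  obtain ⟨u, hu, -, ho⟩ := exists_unit_generator_of_dvd hm hr
  conv_rhs => rw [← zpow_one μ]
  rw [hμ.zpow_eq_zpow_iff, Int.cast_pow, ← hu, ← Units.val_pow_eq_pow_val, ← ho, pow_orderOf_eq_one]
  simp

theorem IsPrimitiveRoot.zpow_pow_injOn (hm : m ∣ N) (hr : orderOf (r : ZMod N) = N.totient)
    (hμ : IsPrimitiveRoot μ m) {i j : ℕ} (hi : i < m.totient) (hj : j < m.totient)
    (h : μ ^ (r ^ i) = μ ^ (r ^ j)) : i = j := by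
  have : NeZero m := ⟨fun h => NeZero.ne N (by simpa [h] using hm)⟩
  obtain ⟨u, hu, -, ho⟩ := exists_unit_generator_of_dvd hm hr
  rw [hμ.zpow_eq_zpow_iff, Int.cast_pow, Int.cast_pow, ← hu, ← Units.val_pow_eq_pow_val,
    ← Units.val_pow_eq_pow_val] at h
  exact pow_injOn_Iio_orderOf (by simpa [ho] using hi) (by simpa [ho] using hj) (Units.ext h)

/-- Primitive `m`-th roots differ by exponents that are units modulo `m`, and each unit is a power
of `r`. Hence one eigenvalue of `a` per order is enough for the classification. -/
theorem IsPrimitiveRoot.exists_zpow_pow_eq (hm : m ∣ N) (hr : orderOf (r : ZMod N) = N.totient)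
    (hμ : IsPrimitiveRoot μ m) {ν : ℂ} (hν : IsPrimitiveRoot ν m) : ∃ j : ℕ, ν ^ (r ^ j) = μ := by
  have : NeZero m := ⟨fun h => NeZero.ne N (by simpa [h] using hm)⟩
  obtain ⟨u, hu, hg, -⟩ := exists_unit_generator_of_dvd hm hr
  obtain ⟨s, -, hs, rfl⟩ := hν.isPrimitiveRoot_iff.1 hμ
  obtain ⟨j, hj⟩ := mem_powers_iff_mem_zpowers.2 (hg (ZMod.unitOfCoprime s hs))
  refine ⟨j, ?_⟩
  rw [← zpow_natCast ν s, hν.zpow_eq_zpow_iff, Int.cast_pow, ← hu, ← Units.val_pow_eq_pow_val]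
  simp only at hj
  rw [hj]
  simp

end PrimitiveRoots

/-- The elements `a`, `b` of `G` are the generators of a presentation of `G` with the
relators `holRels p n r`. -/
structure HolGenerators {G : Type*} [Group G] (p n : ℕ) (r : ℤ) (a b : G) : Prop where
  pow_a : a ^ p ^ n = 1
  pow_b : b ^ (p ^ (n - 1) * (p - 1)) = 1
  conj : b⁻¹ * a * b = a ^ r
  closure : Subgroup.closure {a, b} = ⊤
  lift : ∀ (H : Type) [Group H] (x y : H), x ^ p ^ n = 1 → y ^ (p ^ (n - 1) * (p - 1)) = 1 →
    y⁻¹ * x * y = x ^ r → ∃ f : G →* H, f a = x ∧ f b = y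

/-! ### Groups with the given presentation -/

section HolGenerators

variable {G : Type*} [Group G] {p n : ℕ} {r : ℤ}

theorem exists_hom_of_holRels {H : Type*} [Group H] (x y : H) (hx : x ^ p ^ n = 1)
    (hy : y ^ (p ^ (n - 1) * (p - 1)) = 1) (hxy : y⁻¹ * x * y = x ^ r) :
    ∃ f : PresentedGroup (holRels p n r) →* H,
      f (PresentedGroup.of 0) = x ∧ f (PresentedGroup.of 1) = y := by
  have h : ∀ w ∈ holRels p n r, FreeGroup.lift ![x, y] w = 1 := by
    rintro w (rfl | rfl | rfl)
    · simpa using hx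
    · simpa using hy
    · simp [hxy]
  exact ⟨PresentedGroup.toGroup h, by simp, by simp⟩

theorem HolGenerators.of_equiv (e : PresentedGroup (holRels p n r) ≃* G) :
    HolGenerators p n r (e (PresentedGroup.of 0)) (e (PresentedGroup.of 1)) where
  pow_a := by
    rw [← map_pow, ← map_one e]
    exact congrArg e (PresentedGroup.one_of_mem (rels := holRels p n r) (Or.inl rfl))
  pow_b := by
    rw [← map_pow, ← map_one e]
    exact congrArg e (PresentedGroup.one_of_mem (rels := holRels p n r) (Or.inr (Or.inl rfl)))
  conj := by
    rw [← map_inv, ← map_mul, ← map_mul, ← map_zpow]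
    exact congrArg e
      (PresentedGroup.mk_eq_mk_of_mul_inv_mem (rels := holRels p n r) (Or.inr (Or.inr rfl)))
  closure := by
    have h := PresentedGroup.closure_range_of (holRels p n r)
    have hr : Set.range (PresentedGroup.of : Fin 2 → PresentedGroup (holRels p n r))
        = {PresentedGroup.of 0, PresentedGroup.of 1} := by
      ext x; simp [Fin.exists_fin_two, eq_comm]
    rw [hr] at h
    have h2 := congrArg (Subgroup.map e.toMonoidHom) h
    rw [MonoidHom.map_closure, Subgroup.map_top_of_surjective _ e.surjective] at h2
    simpa [Set.image_pair] using h2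
  lift H _ x y hx hy hxy := by
    obtain ⟨f, hf⟩ := exists_hom_of_holRels x y hx hy hxy
    exact ⟨f.comp e.symm.toMonoidHom, by simpa using hf⟩

theorem conj_pow_eq_zpow_pow {a b : G} (hab : b⁻¹ * a * b = a ^ r) (j : ℕ) :
    (b ^ j)⁻¹ * a * b ^ j = a ^ (r ^ j) := by
  induction j with
  | zero => simp
  | succ j ih =>
    have h1 : (b ^ (j + 1))⁻¹ * a * b ^ (j + 1) = b⁻¹ * ((b ^ j)⁻¹ * a * b ^ j) * b := by
      rw [pow_succ]; group
    have h2 : b⁻¹ * a ^ (r ^ j) * b = (b⁻¹ * a * b) ^ (r ^ j) := by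
      have := conj_zpow (i := r ^ j) (a := b⁻¹) (b := a)
      simpa using this.symm
    rw [h1, ih, h2, hab, ← zpow_mul, pow_succ, mul_comm]

theorem HolGenerators.normal {a b : G} (h : HolGenerators p n r a b)
    (hM : 0 < p ^ (n - 1) * (p - 1)) : (Subgroup.zpowers a).Normal := by
  rw [← Subgroup.normalizer_eq_top_iff, eq_top_iff, ← h.closure, Subgroup.closure_le]
  have hconj : ∀ g : G, g * a * g⁻¹ ∈ Subgroup.zpowers a →
      ∀ x ∈ Subgroup.zpowers a, g * x * g⁻¹ ∈ Subgroup.zpowers a := by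
    rintro g hg x ⟨z, rfl⟩
    have := (Subgroup.zpowers a).zpow_mem hg z
    simpa [conj_zpow] using this
  have hb : b * a * b⁻¹ ∈ Subgroup.zpowers a := by
    -- As `b` has finite order, `b⁻¹` is a power of `b` with natural exponent, so iterating the
    -- relation also controls conjugation in the other direction.
    have hinv : b⁻¹ = b ^ (p ^ (n - 1) * (p - 1) - 1) := by
      rw [inv_eq_iff_mul_eq_one, ← pow_succ', Nat.sub_add_cancel hM, h.pow_b]
    have hc := conj_pow_eq_zpow_pow h.conj (p ^ (n - 1) * (p - 1) - 1)
    rw [← hinv, inv_inv] at hc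
    exact ⟨_, hc.symm⟩
  rintro g (rfl | rfl)
  · exact Subgroup.le_normalizer (Subgroup.mem_zpowers g)
  · rw [SetLike.mem_coe, Subgroup.mem_normalizer_iff]
    refine fun x => ⟨hconj g hb x, fun hx => ?_⟩
    have := hconj g⁻¹ (by rw [inv_inv, h.conj]; exact ⟨r, rfl⟩) _ hx
    simpa [mul_assoc] using this

/-- The product of `⟨b⟩` with the normal subgroup `⟨a⟩` contains both generators. This normal form
is what makes injectivity checks on the presented group possible. -/
theorem HolGenerators.exists_eq_pow_mul_zpow {a b : G} (h : HolGenerators p n r a b)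
    (hM : 0 < p ^ (n - 1) * (p - 1)) (g : G) :
    ∃ (i : ℕ) (z : ℤ), i < p ^ (n - 1) * (p - 1) ∧ g = b ^ i * a ^ z := by
  have := h.normal hM
  have hg : g ∈ Subgroup.zpowers b ⊔ Subgroup.zpowers a := by
    have : Subgroup.closure {a, b} ≤ Subgroup.zpowers b ⊔ Subgroup.zpowers a := by
      rw [Subgroup.closure_le]
      rintro x (rfl | rfl)
      · exact Subgroup.mem_sup_right (Subgroup.mem_zpowers x)
      · exact Subgroup.mem_sup_left (Subgroup.mem_zpowers x)
    exact this (h.closure ▸ Subgroup.mem_top g)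
  obtain ⟨y, ⟨w, rfl⟩, x, ⟨z, rfl⟩, rfl⟩ := Subgroup.mem_sup_of_normal_right.1 hg
  have hM' : (0 : ℤ) < (p ^ (n - 1) * (p - 1) : ℕ) := by exact_mod_cast hM
  set M := p ^ (n - 1) * (p - 1)
  have hnn := Int.emod_nonneg w hM'.ne'
  have hlt := Int.emod_lt_of_pos w hM'
  refine ⟨(w % (M : ℤ)).toNat, z, by omega, ?_⟩
  have hb : b ^ w = b ^ (w % (M : ℤ)).toNat := by
    rw [← zpow_natCast b, Int.toNat_of_nonneg hnn]
    conv_lhs => rw [← Int.emod_add_mul_ediv w M]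
    rw [zpow_add, zpow_mul, zpow_natCast, h.pow_b, one_zpow, mul_one]
  simp [hb]

end HolGenerators

/-! ### The presentation of the holomorph -/

section Presentation

variable {C : Type*} [CommGroup C]

theorem orderOf_powerAut {N : ℕ} {r : ℤ} {x : C} (hx : ∀ c, c ∈ Subgroup.zpowers x)
    (hN : orderOf x = N) {f : MulAut C} (hf : ∀ c, f c = c ^ r) :
    orderOf f = orderOf (r : ZMod N) := by
  have hpow : ∀ (i : ℕ) (c : C), (f ^ i) c = c ^ (r ^ i) := by
    intro i
    induction i with
    | zero => simp
    | succ i ih => intro c; rw [pow_succ', MulAut.mul_apply, ih, hf, ← zpow_mul, pow_succ]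
  rw [orderOf_eq_orderOf_iff]
  intro i
  have h1 : (r : ZMod N) ^ i = 1 ↔ x ^ (r ^ i) = x := by
    rw [← Int.cast_pow, ← Int.cast_one, eq_comm, ZMod.intCast_eq_intCast_iff_dvd_sub, ← hN,
      orderOf_dvd_iff_zpow_eq_one, zpow_sub, zpow_one, mul_inv_eq_one]
  rw [h1]
  constructor
  · intro h
    rw [← hpow, h, MulAut.one_apply]
  · intro h
    ext c
    obtain ⟨z, rfl⟩ := hx c
    rw [hpow, MulAut.one_apply]
    simp only
    rw [← zpow_mul, mul_comm, zpow_mul, h]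

/-- The `r`-th power map `f` generates `MulAut C` by comparison of orders, which gives surjectivity.
Injectivity follows from the normal form `b ^ i * a ^ z`, read off in the two components. -/
theorem nonempty_presentedGroup_mulEquiv_holomorph [IsCyclic C] {p n : ℕ} (hp : p.Prime)
    (hn : 1 ≤ n) (hC : Nat.card C = p ^ n) {r : ℤ}
    (hr : orderOf (r : ZMod (p ^ n)) = p ^ (n - 1) * (p - 1)) :
    Nonempty (PresentedGroup (holRels p n r) ≃* Holomorph C) := by
  have hM : 0 < p ^ (n - 1) * (p - 1) :=
    Nat.mul_pos (pow_pos hp.pos _) (Nat.sub_pos_of_lt hp.one_lt)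
  have hNpos : 0 < p ^ n := pow_pos hp.pos _
  have : Finite C := Nat.finite_of_card_ne_zero (by rw [hC]; exact hNpos.ne')
  obtain ⟨x, hx⟩ := IsCyclic.exists_generator (α := C)
  have hxo : orderOf x = p ^ n := by rw [orderOf_eq_card_of_forall_mem_zpowers hx, hC]
  have hru : IsUnit (r : ZMod (p ^ n)) :=
    IsUnit.of_pow_eq_one (by rw [← hr]; exact pow_orderOf_eq_one _) hM.ne'
  have hsurj : Function.Surjective (zpowGroupHom r : C →* C) := by
    intro c
    obtain ⟨s, hs⟩ := hru.exists_right_inv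
    obtain ⟨t, rfl⟩ := ZMod.intCast_surjective s
    refine ⟨c ^ t, ?_⟩
    rw [← Int.cast_mul, ← Int.cast_one, eq_comm, ZMod.intCast_eq_intCast_iff_dvd_sub, ← hC] at hs
    have h1 : c ^ (r * t - 1) = 1 := by
      obtain ⟨q, hq⟩ := hs
      rw [hq, zpow_mul, zpow_natCast, pow_card_eq_one', one_zpow]
    rw [zpow_sub, zpow_one, mul_inv_eq_one] at h1
    rw [zpowGroupHom_apply, ← zpow_mul, mul_comm, h1]
  let f : MulAut C := MulEquiv.ofBijective (zpowGroupHom r)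
    ⟨Finite.injective_iff_surjective.2 hsurj, hsurj⟩
  have hf : ∀ c, f c = c ^ r := fun c => rfl
  have hfo : orderOf f = p ^ (n - 1) * (p - 1) := by rw [orderOf_powerAut hx hxo hf, hr]
  have hftop : Subgroup.zpowers f = ⊤ := by
    refine Subgroup.eq_top_of_card_eq _ ?_
    rw [Nat.card_zpowers, hfo, IsCyclic.card_mulAut, hC, Nat.totient_prime_pow hp hn]
  let x' : Holomorph C := SemidirectProduct.inl x
  -- The inverse appears because `inr g` conjugates `inl x` to `inl (g x)`, while the relation
  -- conjugates by `b⁻¹`.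
  let y' : Holomorph C := SemidirectProduct.inr f⁻¹
  obtain ⟨F, hF0, hF1⟩ := exists_hom_of_holRels (p := p) (n := n) (r := r) x' y'
    (by rw [← map_pow, ← hxo, pow_orderOf_eq_one, map_one])
    (by rw [← map_pow, inv_pow, ← hfo, pow_orderOf_eq_one, inv_one, map_one])
    (by
      have h1 := SemidirectProduct.inl_aut_inv (φ := MonoidHom.id (MulAut C)) f⁻¹ x
      simp only [MonoidHom.id_apply, inv_inv, hf] at h1
      rw [← map_inv, ← map_zpow, inv_inv, h1])
  refine ⟨MulEquiv.ofBijective F ⟨?_, ?_⟩⟩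
  · rw [injective_iff_map_eq_one]
    intro g hg
    have hgen := HolGenerators.of_equiv (MulEquiv.refl (PresentedGroup (holRels p n r)))
    obtain ⟨i, z, hi, rfl⟩ := hgen.exists_eq_pow_mul_zpow hM g
    simp only [MulEquiv.refl_apply, map_mul, map_pow, map_zpow, hF0, hF1] at hg
    have hR := congrArg SemidirectProduct.right hg
    simp only [SemidirectProduct.mul_right, x', y', ← map_pow, ← map_zpow,
      SemidirectProduct.right_inl, SemidirectProduct.right_inr, mul_one, inv_pow,
      SemidirectProduct.one_right, inv_eq_one] at hR
    have hi0 : i = 0 := Nat.eq_zero_of_dvd_of_lt (orderOf_dvd_of_pow_eq_one hR) (by rwa [hfo])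
    subst hi0
    simp only [pow_zero, one_mul, x', ← map_zpow (SemidirectProduct.inl)] at hg ⊢
    rw [← map_one SemidirectProduct.inl] at hg
    have hz := SemidirectProduct.inl_injective hg
    rw [← orderOf_dvd_iff_zpow_eq_one, hxo] at hz
    obtain ⟨q, rfl⟩ := hz
    rw [zpow_mul, zpow_natCast, hgen.pow_a, one_zpow]
  · intro g
    obtain ⟨z, hz⟩ := hx g.left
    obtain ⟨w, hw⟩ : g.right ∈ Subgroup.zpowers f := hftop ▸ Subgroup.mem_top _
    refine ⟨PresentedGroup.of 0 ^ z * PresentedGroup.of 1 ^ (-w), ?_⟩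
    simp only at hz hw
    rw [map_mul, map_zpow, map_zpow, hF0, hF1, ← map_zpow, ← map_zpow, inv_zpow, zpow_neg, inv_inv,
      hz, hw, SemidirectProduct.inl_left_mul_inr_right]

end Presentation

/-- The representation `R` maps `a` to the diagonal matrix `matA` and `b` to the weighted cyclic
shift `matB`. -/
structure IsShiftRep {G : Type*} [Group G] {d : ℕ} (R : Representation ℂ G (Fin d → ℂ)) (a b : G)
    (ζ : ℂ) (r : ℤ) (m : ℕ) (ω : ℂ) : Prop where
  map_a : R a = Matrix.toLin' (matA d ζ r m)
  map_b : R b = Matrix.toLin' (matB d ω)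

/-! ### Shift representations: irreducibility, universality, existence -/

section ShiftRep

variable {G : Type*} [Group G] {a b : G} {d : ℕ} {ζ ω : ℂ} {r : ℤ} {m : ℕ}
  {R : Representation ℂ G (Fin d → ℂ)}

theorem IsShiftRep.pow_single_zero (h : IsShiftRep R a b ζ r m ω) (hd : 0 < d) (j : ℕ)
    (hj : j < d) : R (b ^ j) (Pi.single ⟨0, hd⟩ 1) = Pi.single ⟨j, hj⟩ 1 := by
  rw [map_pow, h.map_b, matB_pow_single_zero]

theorem IsShiftRep.pow_degree (h : IsShiftRep R a b ζ r m ω) (hd : 0 < d) :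
    R (b ^ d) = ω • (1 : Module.End ℂ (Fin d → ℂ)) := by
  rw [map_pow, h.map_b, matB_pow_degree d ω hd]

theorem IsShiftRep.a_single (h : IsShiftRep R a b ζ r m ω) (j : Fin d) :
    R a (Pi.single j 1) = (ζ ^ m) ^ (r ^ (j : ℕ)) • Pi.single j 1 := by
  rw [h.map_a, matA_single]

theorem IsShiftRep.a_apply (h : IsShiftRep R a b ζ r m ω) (w : Fin d → ℂ) (j : Fin d) :
    R a w j = (ζ ^ m) ^ (r ^ (j : ℕ)) * w j := by
  have h2 : (ζ ^ m) ^ (r ^ (j : ℕ)) = ζ ^ (r ^ (j : ℕ) * (m : ℤ)) := by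
    rw [mul_comm, zpow_mul, zpow_natCast]
  rw [h.map_a, h2]
  simp [matA, Matrix.mulVec_diagonal]

/-- Since the eigenvalues of `a` are distinct, its eigenvectors are multiples of the standard basis
vectors. -/
theorem IsShiftRep.eq_smul_single (h : IsShiftRep R a b ζ r m ω)
    (hinj : ∀ i j : ℕ, i < d → j < d → (ζ ^ m) ^ (r ^ i) = (ζ ^ m) ^ (r ^ j) → i = j)
    {ν : ℂ} {w : Fin d → ℂ} (hw : R a w = ν • w) {j : Fin d} (hj : w j ≠ 0) :
    w = w j • Pi.single j 1 := by
  have hcoord : ∀ i : Fin d, (ζ ^ m) ^ (r ^ (i : ℕ)) * w i = ν * w i := fun i => by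
    rw [← h.a_apply, hw]; simp
  ext i
  by_cases hij : i = j
  · subst hij; simp
  · have hνj := mul_right_cancel₀ hj (hcoord j)
    have : w i = 0 := by
      by_contra hi
      have hνi := mul_right_cancel₀ hi (hcoord i)
      exact hij (Fin.ext (hinj i j i.2 j.2 (hνi.trans hνj.symm)))
    simp [this, hij]

/-- A nonzero subrepresentation contains an eigenvector of `a`. As the eigenvalues are distinct, it
is a multiple of a basis vector, and powers of `b` then reach all basis vectors. -/
theorem IsShiftRep.isIrreducible (h : IsShiftRep R a b ζ r m ω) (hd : 0 < d)
    (hinj : ∀ i j : ℕ, i < d → j < d → (ζ ^ m) ^ (r ^ i) = (ζ ^ m) ^ (r ^ j) → i = j) :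
    R.IsIrreducible := by
  have : NeZero d := ⟨hd.ne'⟩
  have hsub := Subrepresentation.toSubmodule_injective (ρ := R)
  have hnt : Nontrivial (Subrepresentation R) := ⟨⊥, ⊤, fun e => by
    have := congrArg Subrepresentation.toSubmodule e
    exact bot_ne_top (α := Submodule ℂ (Fin d → ℂ)) this⟩
  refine ⟨fun W => or_iff_not_imp_left.2 fun hW => hsub ?_⟩
  have hne : W.toSubmodule ≠ ⊥ := fun e => hW (hsub e)
  have : Nontrivial W.toSubmodule := Submodule.nontrivial_iff_ne_bot.2 hne
  obtain ⟨ν, hν⟩ := Module.End.exists_eigenvalue (W.toRepresentation a)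
  obtain ⟨⟨w, hwW⟩, hw⟩ := hν.exists_hasEigenvector
  have hw0 : w ≠ 0 := fun e => hw.2 (Subtype.ext e)
  have hwa : R a w = ν • w := congrArg Subtype.val hw.apply_eq_smul
  obtain ⟨j, hj⟩ := Function.ne_iff.1 hw0
  have hej : Pi.single j 1 ∈ W.toSubmodule := by
    rw [h.eq_smul_single hinj hwa hj] at hwW
    exact (W.toSubmodule.smul_mem_iff hj).1 hwW
  have he0 : Pi.single ⟨0, hd⟩ 1 ∈ W.toSubmodule := by
    have h1 := W.apply_mem_toSubmodule (b ^ (j : ℕ))⁻¹ hej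
    rwa [← h.pow_single_zero hd j j.2, Representation.inv_self_apply] at h1
  have htop : (⊤ : Submodule ℂ (Fin d → ℂ)) ≤ W.toSubmodule := by
    rw [← (Pi.basisFun ℂ (Fin d)).span_eq, Submodule.span_le]
    rintro _ ⟨i, rfl⟩
    rw [Pi.basisFun_apply, ← h.pow_single_zero hd i i.2]
    exact W.apply_mem_toSubmodule _ he0
  exact top_le_iff.1 htop

variable {V : Type*} [AddCommGroup V] [Module ℂ V]

/-- The universal property of the shift representations. -/
theorem IsShiftRep.exists_intertwiningMap (h : IsShiftRep R a b ζ r m ω) (hd : 0 < d)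
    (hab : b⁻¹ * a * b = a ^ r) (hgen : Subgroup.closure {a, b} = ⊤)
    (hζ : ζ ≠ 0) (σ : Representation ℂ G V) {v : V} (ha : σ a v = ζ ^ m • v)
    (hb : σ (b ^ d) v = ω • v) :
    ∃ Φ : R.IntertwiningMap σ, Φ (Pi.single ⟨0, hd⟩ 1) = v := by
  -- The map is forced, since the `j`-th basis vector is `b ^ j` applied to the first one.
  let f : (Fin d → ℂ) →ₗ[ℂ] V := (Pi.basisFun ℂ (Fin d)).constr ℂ fun j => σ (b ^ (j : ℕ)) v
  have hf : ∀ j : Fin d, f (Pi.single j 1) = σ (b ^ (j : ℕ)) v := fun j => by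
    rw [← Pi.basisFun_apply, Module.Basis.constr_basis]
  have hcomm : ∀ g ∈ ({a, b} : Set G), f ∘ₗ R g = σ g ∘ₗ f := by
    rintro g (rfl | rfl)
    · refine LinearMap.pi_ext' fun j => LinearMap.ext_ring ?_
      simp only [LinearMap.comp_apply, LinearMap.single_apply]
      rw [h.a_single, map_smul, hf, σ.eigenvector_pow_translate hab (pow_ne_zero _ hζ) ha]
    · refine LinearMap.pi_ext' fun j => LinearMap.ext_ring ?_
      simp only [LinearMap.comp_apply, LinearMap.single_apply]
      rw [hf, h.map_b, ← Module.End.mul_apply, ← map_mul, ← pow_succ']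
      by_cases hj : (j : ℕ) + 1 < d
      · rw [matB_single_succ d ω j hj, hf]
      · have hj' : (j : ℕ) = d - 1 := by omega
        have hj2 : j = ⟨d - 1, by omega⟩ := Fin.ext hj'
        rw [hj2, matB_single_last d ω hd, map_smul, hf]
        simp only [pow_zero, map_one, Module.End.one_apply, Nat.sub_add_cancel hd, hb]
  refine ⟨⟨f, R.comp_eq_of_closure_eq_top σ hgen f hcomm⟩, ?_⟩
  rw [Representation.IntertwiningMap.coe_mk, hf]
  simp

theorem HolGenerators.exists_isShiftRep {p n : ℕ} (h : HolGenerators p n r a b) (hp : 0 < p)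
    (hM : 0 < p ^ (n - 1) * (p - 1)) (hζ : ζ ^ p ^ n = 1)
    (hper : (ζ ^ m) ^ (r ^ d) = ζ ^ m) {E : ℕ} (hE : d * E = p ^ (n - 1) * (p - 1))
    (hω : ω ^ E = 1) :
    ∃ R : Representation ℂ G (Fin d → ℂ), IsShiftRep R a b ζ r m ω := by
  have hN : p ^ n ≠ 0 := (pow_pos hp n).ne'
  have hζ0 : ζ ≠ 0 := fun e => by rw [e, zero_pow hN] at hζ; exact zero_ne_one hζ
  have hμ0 : ζ ^ m ≠ 0 := pow_ne_zero _ hζ0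
  have hd : 0 < d := Nat.pos_of_ne_zero fun e => by rw [e, zero_mul] at hE; omega
  set A := Matrix.toLin' (matA d ζ r m) with hA
  set B := Matrix.toLin' (matB d ω) with hB
  have hApow : ∀ (i : ℕ) (j : Fin d),
      (A ^ i) (Pi.single j 1) = ((ζ ^ m) ^ (r ^ (j : ℕ))) ^ i • Pi.single j 1 := by
    intro i j
    induction i with
    | zero => simp
    | succ i ih => rw [pow_succ', Module.End.mul_apply, ih, map_smul, hA, matA_single, smul_smul,
        pow_succ]
  have hA1 : A ^ p ^ n = 1 := by
    refine LinearMap.pi_ext' fun j => LinearMap.ext_ring ?_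
    simp only [LinearMap.comp_apply, LinearMap.single_apply, Module.End.one_apply]
    have h1 : ((ζ ^ m) ^ (r ^ (j : ℕ))) ^ p ^ n = 1 := by
      rw [← zpow_natCast, ← zpow_mul, mul_comm, zpow_mul, zpow_natCast, ← pow_mul, mul_comm m,
        pow_mul, hζ, one_pow, one_zpow]
    rw [hApow, h1, one_smul]
  have hB1 : B ^ (p ^ (n - 1) * (p - 1)) = 1 := by
    rw [← hE, pow_mul, hB, matB_pow_degree d ω hd, smul_pow, one_pow, hω, one_smul]
  let x : (Module.End ℂ (Fin d → ℂ))ˣ := Units.ofPowEqOne A _ hA1 hN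
  let y : (Module.End ℂ (Fin d → ℂ))ˣ := Units.ofPowEqOne B _ hB1 hM.ne'
  have hxv : (x : Module.End ℂ (Fin d → ℂ)) = A := rfl
  have hyv : (y : Module.End ℂ (Fin d → ℂ)) = B := rfl
  have hxz : ∀ j : Fin d, ((x ^ r : (Module.End ℂ (Fin d → ℂ))ˣ) : Module.End ℂ (Fin d → ℂ))
      (Pi.single j 1) = (ζ ^ m) ^ (r ^ ((j : ℕ) + 1)) • Pi.single j 1 := by
    intro j
    have h1 := Representation.zpow_apply_of_eigenvector
      (Units.coeHom (Module.End ℂ (Fin d → ℂ)) :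
        Representation ℂ (Module.End ℂ (Fin d → ℂ))ˣ (Fin d → ℂ))
      (a := x) (μ := (ζ ^ m) ^ (r ^ (j : ℕ))) (v := Pi.single j 1) (zpow_ne_zero _ hμ0)
      (matA_single d ζ r m j) r
    rw [← zpow_mul, ← pow_succ] at h1
    exact h1
  have hxy : x * y = y * x ^ r := by
    refine Units.ext (LinearMap.pi_ext' fun j => LinearMap.ext_ring ?_)
    simp only [LinearMap.comp_apply, LinearMap.single_apply, Units.val_mul, Module.End.mul_apply]
    rw [hxz, map_smul, hxv, hyv, hA, hB]
    by_cases hj : (j : ℕ) + 1 < d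
    · rw [matB_single_succ d ω j hj, matA_single]
    -- The shift wraps round in the last column, and the two sides agree because `hper` identifies
    -- the weights of exponents `r ^ d` and `1`.
    · have hj2 : j = ⟨d - 1, by omega⟩ := Fin.ext (by simp only; omega)
      rw [hj2, matB_single_last d ω hd, map_smul, matA_single]
      simp only [Nat.sub_add_cancel hd, hper, pow_zero, zpow_one]
      rw [smul_comm]
  obtain ⟨f, hfa, hfb⟩ := h.lift _ x y (Units.ext (by simpa [hxv] using hA1))
    (Units.ext (by simpa [hyv] using hB1)) (by rw [mul_assoc, hxy, inv_mul_cancel_left])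
  exact ⟨(Units.coeHom _).comp f, by simp [hfa, hxv, hA], by simp [hfb, hyv, hB]⟩

/-- By periodicity `b ^ d` sends the `μ`-eigenspace of `a` to itself, so it has an eigenvector
there. -/
theorem Representation.exists_common_eigenvector [FiniteDimensional ℂ V]
    (σ : Representation ℂ G V) (hab : b⁻¹ * a * b = a ^ r) {μ : ℂ} (hμ : μ ≠ 0) {d : ℕ}
    (hper : μ ^ (r ^ d) = μ) {u : V} (hu : u ≠ 0) (hau : σ a u = μ • u) :
    ∃ (v : V) (ω : ℂ), v ≠ 0 ∧ σ a v = μ • v ∧ σ (b ^ d) v = ω • v := by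
  let W := Module.End.eigenspace (σ a) μ
  have hmem : ∀ v, v ∈ W ↔ σ a v = μ • v := fun v => Module.End.mem_eigenspace_iff
  have hinv : ∀ v ∈ W, σ (b ^ d) v ∈ W := fun v hv => by
    have := σ.eigenvector_pow_translate hab hμ ((hmem v).1 hv) d
    rw [hper] at this
    exact (hmem _).2 this
  have : Nontrivial W := ⟨⟨u, (hmem u).2 hau⟩, 0, fun e => hu (congrArg Subtype.val e)⟩
  obtain ⟨ω, hω⟩ := Module.End.exists_eigenvalue ((σ (b ^ d)).restrict hinv)
  obtain ⟨⟨v, hv⟩, hvω⟩ := hω.exists_hasEigenvector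
  exact ⟨v, ω, fun e => hvω.2 (Subtype.ext e), (hmem v).1 hv,
    congrArg Subtype.val hvω.apply_eq_smul⟩

theorem HolGenerators.pow_eq_one_of_eigenvector {p n : ℕ} (h : HolGenerators p n r a b)
    (σ : Representation ℂ G V) {E : ℕ} (hE : d * E = p ^ (n - 1) * (p - 1)) {v : V} (hv : v ≠ 0)
    (hω : σ (b ^ d) v = ω • v) : ω ^ E = 1 := by
  have h1 : ∀ i : ℕ, σ ((b ^ d) ^ i) v = ω ^ i • v := by
    intro i
    induction i with
    | zero => simp
    | succ i ih => rw [pow_succ, map_mul, Module.End.mul_apply, hω, map_smul, ih, smul_smul,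
        pow_succ']
  have h2 := h1 E
  rw [← pow_mul, hE, h.pow_b, map_one, Module.End.one_apply] at h2
  exact smul_left_injective ℂ hv (by simpa using h2.symm)

/-- Any eigenvalue of `a` has order `p ^ k` for some `k ≤ n`, and a power of `b` moves it to the
chosen primitive root of that order. -/
theorem HolGenerators.exists_eigenvector {p n : ℕ} (hp : p.Prime) (h : HolGenerators p n r a b)
    (hr : orderOf (r : ZMod (p ^ n)) = (p ^ n).totient) (hζ : IsPrimitiveRoot ζ (p ^ n))
    [FiniteDimensional ℂ V] [Nontrivial V] (σ : Representation ℂ G V) :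
    ∃ k ≤ n, ∃ u : V, u ≠ 0 ∧ σ a u = ζ ^ p ^ (n - k) • u := by
  have hpn : p ^ n ≠ 0 := (pow_pos hp.pos n).ne'
  have : NeZero (p ^ n) := ⟨hpn⟩
  obtain ⟨ν, hν⟩ := Module.End.exists_eigenvalue (σ a)
  obtain ⟨u, hu⟩ := hν.exists_hasEigenvector
  have hau : σ a u = ν • u := hu.apply_eq_smul
  have hpow : ∀ i : ℕ, σ (a ^ i) u = ν ^ i • u := by
    intro i
    induction i with
    | zero => simp
    | succ i ih => rw [pow_succ, map_mul, Module.End.mul_apply, hau, map_smul, ih, smul_smul,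
        pow_succ']
  have hν1 : ν ^ p ^ n = 1 := by
    have h2 := hpow (p ^ n)
    rw [h.pow_a, map_one, Module.End.one_apply] at h2
    exact smul_left_injective ℂ hu.2 (by simpa using h2.symm)
  have hν0 : ν ≠ 0 := fun e => by rw [e, zero_pow hpn] at hν1; exact zero_ne_one hν1
  obtain ⟨k, hk, hko⟩ := (Nat.dvd_prime_pow hp).1 (orderOf_dvd_of_pow_eq_one hν1)
  have hνp : IsPrimitiveRoot ν (p ^ k) := hko ▸ IsPrimitiveRoot.orderOf ν
  have hμp : IsPrimitiveRoot (ζ ^ p ^ (n - k)) (p ^ k) :=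
    hζ.pow (pow_pos hp.pos n) (by rw [← pow_add, Nat.sub_add_cancel hk])
  obtain ⟨j, hj⟩ := hμp.exists_zpow_pow_eq (pow_dvd_pow p hk) hr hνp
  refine ⟨k, hk, σ (b ^ j) u, fun e => hu.2 ?_, ?_⟩
  · have := congrArg (σ (b ^ j)⁻¹) e
    rwa [Representation.inv_self_apply, map_zero] at this
  · rw [σ.eigenvector_pow_translate h.conj hν0 hau, hj]

end ShiftRep

/-! ### Degree and faithfulness of equivalence classes -/

section IrrClasses

variable {G : Type*} [Group G]

theorem Irr.mk_eq_mk_iff {d d' : ℕ} {R : Representation ℂ G (Fin d → ℂ)}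
    {S : Representation ℂ G (Fin d' → ℂ)} {hR : R.IsIrreducible} {hS : S.IsIrreducible} :
    Irr.mk R hR = Irr.mk S hS ↔ Nonempty (R.Equiv S) :=
  Quotient.eq (r := CIrrep.setoid G)

theorem Irr.exists_mk_eq (c : Irr G) : ∃ (d : ℕ) (R : Representation ℂ G (Fin d → ℂ))
    (hR : R.IsIrreducible), Irr.mk R hR = c := by
  induction c using Quotient.inductionOn with
  | h c => exact ⟨c.dim, c.rep, c.irred, rfl⟩

theorem degree_eq_of_equiv {d d' : ℕ} {R : Representation ℂ G (Fin d → ℂ)}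
    {S : Representation ℂ G (Fin d' → ℂ)} (e : R.Equiv S) : d = d' := by
  have := e.toLinearEquiv.finrank_eq
  simpa using this

theorem Irr.hasDegree_mk_iff {d d' : ℕ} {R : Representation ℂ G (Fin d → ℂ)}
    {hR : R.IsIrreducible} : (Irr.mk R hR).HasDegree d' ↔ d' = d := by
  constructor
  · rintro ⟨S, hS, h⟩
    obtain ⟨e⟩ := Irr.mk_eq_mk_iff.1 h
    exact degree_eq_of_equiv e
  · rintro rfl
    exact ⟨R, hR, rfl⟩

theorem Irr.isFaithful_mk_iff {d : ℕ} {R : Representation ℂ G (Fin d → ℂ)}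
    {hR : R.IsIrreducible} : (Irr.mk R hR).IsFaithful ↔ Function.Injective R := by
  constructor
  · rintro ⟨d', S, hS, h, hinj⟩ g g' hgg
    obtain ⟨e⟩ := Irr.mk_eq_mk_iff.1 h
    refine hinj ?_
    rw [← Representation.Equiv.conj_apply_self g e.symm,
      ← Representation.Equiv.conj_apply_self g' e.symm, hgg]
  · intro h
    exact ⟨d, R, hR, rfl, h⟩

end IrrClasses

/-! ### Induced representations -/

section Induction

variable {G : Type*} [Group G] {I : Subgroup G} {A B : Type*} [AddCommGroup A] [Module ℂ A]
  [AddCommGroup B] [Module ℂ B] (τ : Representation ℂ I A)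

open Representation

theorem Representation.ind_apply_mk_one (g : I) (v : A) :
    ind I.subtype τ g (IndV.mk I.subtype τ 1 v) = IndV.mk I.subtype τ 1 (τ g v) := by
  rw [ind_mk]
  have h := Coinvariants.mk_self_apply (tprod ((leftRegular ℂ G).comp I.subtype) τ) g
    (MonoidAlgebra.single ((g : G)⁻¹) 1 ⊗ₜ[ℂ] v)
  simp only [tprod_apply, TensorProduct.map_tmul] at h
  simpa using h.symm

/-- Half of Frobenius reciprocity, kept as a linear map: it serves to show that a vector of the
induced space is nonzero. The inverse in `σ h⁻¹` matches the convention that `g` sends the class at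
`h` to the class at `h * g⁻¹`. -/
theorem Representation.exists_ind_lift (σ : Representation ℂ G B) (f : A →ₗ[ℂ] B)
    (hf : ∀ (g : I) (v : A), f (τ g v) = σ g (f v)) :
    ∃ Ψ : IndV I.subtype τ →ₗ[ℂ] B, ∀ (h : G) (v : A),
      Ψ (IndV.mk I.subtype τ h v) = σ h⁻¹ (f v) := by
  refine ⟨Coinvariants.lift _ (TensorProduct.lift <|
    (Finsupp.lift _ _ _ fun h => σ h⁻¹ ∘ₗ f) ∘ₗ
      (MonoidAlgebra.coeffLinearEquiv ℂ).toLinearMap) fun g => ?_, fun h v => ?_⟩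
  · ext h x
    simp only [LinearMap.coe_comp, Function.comp_apply, MonoidAlgebra.lsingle_apply]
    simp [ofMulAction_single, mul_inv_rev, hf g]
  · simp

/-- The translates of the copy of `τ` at `1` span the induced space, so the quotient map by `W`
vanishes. -/
theorem Representation.ind_eq_top_of_mk_one_mem (W : Subrepresentation (ind I.subtype τ))
    (hW : ∀ v, IndV.mk I.subtype τ 1 v ∈ W.toSubmodule) : W.toSubmodule = ⊤ := by
  have h : W.toSubmodule.mkQ = 0 := by
    refine IndV.hom_ext _ _ fun g => LinearMap.ext fun v => ?_
    have h1 := W.apply_mem_toSubmodule g⁻¹ (hW v)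
    rw [ind_mk, inv_inv, one_mul] at h1
    simpa using (Submodule.Quotient.mk_eq_zero _).2 h1
  rw [← Submodule.ker_mkQ W.toSubmodule, h, LinearMap.ker_zero]

end Induction

/-! ### Stabilisers of characters -/

section Inertia

variable {G : Type*} [Group G]

theorem le_inertiaGroup {N : Subgroup G} [N.Normal] (χ : N →* ℂˣ) : N ≤ inertiaGroup χ := by
  intro g hg
  change conjChar χ g = χ
  ext x
  have h : MulAut.conjNormal g⁻¹ x = (⟨g, hg⟩ : N)⁻¹ * x * ⟨g, hg⟩ :=
    Subtype.ext (by simp)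
  change ((χ (MulAut.conjNormal g⁻¹ x) : ℂˣ) : ℂ) = _
  rw [h, map_mul, map_mul, map_inv, mul_right_comm, inv_mul_cancel, one_mul]

theorem conjChar_apply_conj {N : Subgroup G} [N.Normal] (χ : N →* ℂˣ) (g : G) (x : N) :
    conjChar χ g (MulAut.conjNormal g x) = χ x := by
  simp [conjChar]

end Inertia

/-- The standing hypotheses: `a`, `b` generate `G` with the relations of the holomorph of the
cyclic group of order `p ^ n`, for a generator `r` of the units modulo `p ^ n`, and `ζ` is a
primitive `p ^ n`-th root of unity. -/
structure HolSetup {G : Type*} [Group G] (p n : ℕ) (r : ℤ) (ζ : ℂ) (a b : G) : Prop where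
  prime : p.Prime
  odd : Odd p
  one_le : 1 ≤ n
  order : orderOf (r : ZMod (p ^ n)) = (p ^ n).totient
  root : IsPrimitiveRoot ζ (p ^ n)
  gens : HolGenerators p n r a b

/-- The number of irreducible representations of degree `φ (p ^ k)`. -/
def shiftExponent (p n k : ℕ) : ℕ := if k = 0 then p ^ (n - 1) * (p - 1) else p ^ (n - k)

/-- This makes the eigenvalues of `b ^ φ(p ^ k)` roots of unity of order dividing `shiftExponent p n
k`. The case `k = 0` is separate because `φ(1) = 1` does not follow the pattern `p ^ (k - 1) * (p -
1)`. -/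
theorem totient_mul_shiftExponent {p n k : ℕ} (hp : p.Prime) (hk : k ≤ n) :
    (p ^ k).totient * shiftExponent p n k = p ^ (n - 1) * (p - 1) := by
  unfold shiftExponent
  split_ifs with h0
  · simp [h0]
  · rw [Nat.totient_prime_pow hp (by omega), mul_right_comm, ← pow_add]
    congr 2
    omega

theorem shiftExponent_pos {p n : ℕ} (hp : p.Prime) (k : ℕ) : 0 < shiftExponent p n k := by
  unfold shiftExponent
  split_ifs
  · exact Nat.mul_pos (pow_pos hp.pos _) (Nat.sub_pos_of_lt hp.one_lt)
  · exact pow_pos hp.pos _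

/-- Oddness excludes the coincidence `φ(1) = φ(2)`; thus the degree recovers `k`. -/
theorem totient_prime_pow_injective {p : ℕ} (hp : p.Prime) (hodd : Odd p) :
    Function.Injective fun k => (p ^ k).totient := by
  have h3 : 3 ≤ p := by
    have := hp.two_le
    obtain ⟨q, hq⟩ := hodd
    omega
  refine StrictMono.injective (strictMono_nat_of_lt_succ fun k => ?_)
  change (p ^ k).totient < (p ^ (k + 1)).totient
  rcases Nat.eq_zero_or_pos k with rfl | hk
  · rw [zero_add, pow_one, pow_zero, Nat.totient_one, Nat.totient_prime hp]
    omega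
  · rw [Nat.totient_prime_pow hp hk, Nat.totient_prime_pow_succ hp]
    exact Nat.mul_lt_mul_of_pos_right (Nat.pow_lt_pow_right hp.one_lt (by omega)) (by omega)

/-! ### Classification by degree, counting, faithfulness -/

namespace HolSetup

variable {G : Type*} [Group G] {p n : ℕ} {r : ℤ} {ζ : ℂ} {a b : G}

theorem exponent_pos (h : HolSetup p n r ζ a b) : 0 < p ^ (n - 1) * (p - 1) :=
  Nat.mul_pos (pow_pos h.prime.pos _) (Nat.sub_pos_of_lt h.prime.one_lt)

theorem degree_pos (h : HolSetup p n r ζ a b) (k : ℕ) : 0 < (p ^ k).totient :=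
  Nat.totient_pos.2 (pow_pos h.prime.pos k)

theorem ne_zero (h : HolSetup p n r ζ a b) : ζ ≠ 0 :=
  h.root.ne_zero (pow_pos h.prime.pos n).ne'

theorem weight_root (h : HolSetup p n r ζ a b) {k : ℕ} (hk : k ≤ n) :
    IsPrimitiveRoot (ζ ^ p ^ (n - k)) (p ^ k) :=
  h.root.pow (pow_pos h.prime.pos n) (by rw [← pow_add, Nat.sub_add_cancel hk])

theorem weight_periodic (h : HolSetup p n r ζ a b) {k : ℕ} (hk : k ≤ n) :
    (ζ ^ p ^ (n - k)) ^ (r ^ (p ^ k).totient) = ζ ^ p ^ (n - k) := by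
  have : NeZero (p ^ n) := ⟨(pow_pos h.prime.pos n).ne'⟩
  exact (h.weight_root hk).zpow_pow_totient (pow_dvd_pow p hk) h.order

theorem weight_injective (h : HolSetup p n r ζ a b) {k : ℕ} (hk : k ≤ n) (i j : ℕ)
    (hi : i < (p ^ k).totient) (hj : j < (p ^ k).totient)
    (hij : (ζ ^ p ^ (n - k)) ^ (r ^ i) = (ζ ^ p ^ (n - k)) ^ (r ^ j)) : i = j := by
  have : NeZero (p ^ n) := ⟨(pow_pos h.prime.pos n).ne'⟩
  exact (h.weight_root hk).zpow_pow_injOn (pow_dvd_pow p hk) h.order hi hj hij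

theorem isIrreducible (h : HolSetup p n r ζ a b) {k : ℕ} (hk : k ≤ n) {ω : ℂ}
    {R : Representation ℂ G (Fin (p ^ k).totient → ℂ)}
    (hR : IsShiftRep R a b ζ r (p ^ (n - k)) ω) : R.IsIrreducible :=
  hR.isIrreducible (h.degree_pos k) (h.weight_injective hk)

theorem exists_shiftReps (h : HolSetup p n r ζ a b) {k : ℕ} (hk : k ≤ n) :
    ∃ ρ : rootsOfUnity (shiftExponent p n k) ℂ →
        Representation ℂ G (Fin (p ^ k).totient → ℂ),
      ∀ ω, IsShiftRep (ρ ω) a b ζ r (p ^ (n - k)) ((ω : ℂˣ) : ℂ) := by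
  suffices H : ∀ ω : rootsOfUnity (shiftExponent p n k) ℂ,
      ∃ R : Representation ℂ G (Fin (p ^ k).totient → ℂ),
        IsShiftRep R a b ζ r (p ^ (n - k)) ((ω : ℂˣ) : ℂ) from
    ⟨fun ω => (H ω).choose, fun ω => (H ω).choose_spec⟩
  intro ω
  refine h.gens.exists_isShiftRep h.prime.pos h.exponent_pos h.root.pow_eq_one
    (h.weight_periodic hk) (totient_mul_shiftExponent h.prime hk) ?_
  have hω := congrArg Units.val ((mem_rootsOfUnity _ _).1 ω.2)
  rwa [Units.val_pow_eq_pow_val, Units.val_one] at hω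

/-- An irreducible representation in which `a` has the eigenvalue `ζ ^ p ^ (n - k)` is a shift
representation of degree `φ (p ^ k)`. -/
theorem exists_equiv_of_eigenvector (h : HolSetup p n r ζ a b) {k : ℕ} (hk : k ≤ n)
    {V : Type*} [AddCommGroup V] [Module ℂ V] [FiniteDimensional ℂ V] {σ : Representation ℂ G V}
    (hσ : σ.IsIrreducible) {u : V} (hu : u ≠ 0) (hau : σ a u = ζ ^ p ^ (n - k) • u) :
    ∃ ω : rootsOfUnity (shiftExponent p n k) ℂ,
      ∀ R : Representation ℂ G (Fin (p ^ k).totient → ℂ),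
        IsShiftRep R a b ζ r (p ^ (n - k)) ((ω : ℂˣ) : ℂ) → Nonempty (R.Equiv σ) := by
  have : NeZero (shiftExponent p n k) := ⟨(shiftExponent_pos h.prime k).ne'⟩
  obtain ⟨v, ω, hv, hav, hbv⟩ := σ.exists_common_eigenvector h.gens.conj
    (pow_ne_zero _ h.ne_zero) (h.weight_periodic hk) hu hau
  have hω := h.gens.pow_eq_one_of_eigenvector σ (totient_mul_shiftExponent h.prime hk) hv hbv
  refine ⟨rootsOfUnity.mkOfPowEq ω hω, fun R hR => ?_⟩
  rw [rootsOfUnity.coe_mkOfPowEq] at hR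
  obtain ⟨Φ, hΦ⟩ := hR.exists_intertwiningMap (h.degree_pos k) h.gens.conj h.gens.closure
    h.ne_zero σ hav hbv
  have := h.isIrreducible hk hR
  -- Schur's lemma applies, and `Φ` is nonzero because it takes the value `v`.
  rcases Representation.IsIrreducible.bijective_or_eq_zero Φ with hb | h0
  · exact ⟨Φ.ofBijective hb⟩
  · rw [h0] at hΦ
    exact absurd hΦ.symm hv

theorem exists_shiftRep_of_irr (h : HolSetup p n r ζ a b) (c : Irr G) :
    ∃ k ≤ n, ∃ (ω : rootsOfUnity (shiftExponent p n k) ℂ)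
      (R : Representation ℂ G (Fin (p ^ k).totient → ℂ)) (hR : R.IsIrreducible),
      IsShiftRep R a b ζ r (p ^ (n - k)) ((ω : ℂˣ) : ℂ) ∧ Irr.mk R hR = c := by
  obtain ⟨d, S, hS, rfl⟩ := c.exists_mk_eq
  have := hS.nontrivial
  obtain ⟨k, hk, u, hu, hau⟩ := h.gens.exists_eigenvector h.prime h.order h.root S
  obtain ⟨ω, hω⟩ := h.exists_equiv_of_eigenvector hk hS hu hau
  obtain ⟨ρ, hρ⟩ := h.exists_shiftReps hk
  exact ⟨k, hk, ω, ρ ω, h.isIrreducible hk (hρ ω), hρ ω, Irr.mk_eq_mk_iff.2 (hω _ (hρ ω))⟩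

theorem exists_shiftRep_of_hasDegree (h : HolSetup p n r ζ a b) {k : ℕ} {c : Irr G}
    (hc : c.HasDegree (p ^ k).totient) :
    ∃ (ω : rootsOfUnity (shiftExponent p n k) ℂ)
      (R : Representation ℂ G (Fin (p ^ k).totient → ℂ)) (hR : R.IsIrreducible),
      IsShiftRep R a b ζ r (p ^ (n - k)) ((ω : ℂˣ) : ℂ) ∧ Irr.mk R hR = c := by
  obtain ⟨k', hk', ω, R, hR, hS, rfl⟩ := h.exists_shiftRep_of_irr c
  obtain rfl := totient_prime_pow_injective h.prime h.odd (Irr.hasDegree_mk_iff.1 hc)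
  exact ⟨ω, R, hR, hS, rfl⟩

/-- The element `b ^ d` acts as the scalar `ω`, which an equivalence preserves. -/
theorem _root_.IsShiftRep.scalar_eq_of_equiv {d m : ℕ} {ω ω' : ℂ} (hd : 0 < d)
    {R S : Representation ℂ G (Fin d → ℂ)} (hR : IsShiftRep R a b ζ r m ω)
    (hS : IsShiftRep S a b ζ r m ω') (e : R.Equiv S) : ω = ω' := by
  have : NeZero d := ⟨hd.ne'⟩
  obtain ⟨v, hv⟩ := exists_ne (0 : Fin d → ℂ)
  have h1 := e.toIntertwiningMap.isIntertwining R S (b ^ d) v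
  rw [hR.pow_degree hd, hS.pow_degree hd] at h1
  simp only [LinearMap.smul_apply, Module.End.one_apply, map_smul] at h1
  refine smul_left_injective ℂ (fun e0 => hv ?_) h1
  exact e.toLinearEquiv.map_eq_zero_iff.1 e0

theorem bijOn_hasDegree (h : HolSetup p n r ζ a b) {k : ℕ}
    (ρ : rootsOfUnity (shiftExponent p n k) ℂ → Representation ℂ G (Fin (p ^ k).totient → ℂ))
    (hρ : ∀ ω, IsShiftRep (ρ ω) a b ζ r (p ^ (n - k)) ((ω : ℂˣ) : ℂ))
    (hirr : ∀ ω, (ρ ω).IsIrreducible) :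
    Set.BijOn (fun ω => Irr.mk (ρ ω) (hirr ω)) Set.univ
      {c : Irr G | c.HasDegree (p ^ k).totient} := by
  have hd := h.degree_pos k
  refine ⟨fun ω _ => ⟨ρ ω, hirr ω, rfl⟩, fun ω _ ω' _ hω => ?_, fun c hc => ?_⟩
  · obtain ⟨e⟩ := Irr.mk_eq_mk_iff.1 hω
    exact Subtype.ext (Units.ext ((hρ ω).scalar_eq_of_equiv hd (hρ ω') e))
  · obtain ⟨ω, R, hR, hS, rfl⟩ := h.exists_shiftRep_of_hasDegree hc
    refine ⟨ω, trivial, Irr.mk_eq_mk_iff.2 ⟨?_⟩⟩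
    refine Representation.Equiv.mk (LinearEquiv.refl ℂ _)
      ((ρ ω).comp_eq_of_closure_eq_top R h.gens.closure LinearMap.id ?_)
    rintro g (rfl | rfl)
    · rw [hS.map_a, (hρ ω).map_a, LinearMap.id_comp, LinearMap.comp_id]
    · rw [hS.map_b, (hρ ω).map_b, LinearMap.id_comp, LinearMap.comp_id]

theorem ncard_hasDegree (h : HolSetup p n r ζ a b) {k : ℕ} (hk : k ≤ n) :
    {c : Irr G | c.HasDegree (p ^ k).totient}.ncard = shiftExponent p n k := by
  have : NeZero (shiftExponent p n k) := ⟨(shiftExponent_pos h.prime k).ne'⟩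
  obtain ⟨ρ, hρ⟩ := h.exists_shiftReps hk
  have hb := h.bijOn_hasDegree ρ hρ fun ω => h.isIrreducible hk (hρ ω)
  rw [← hb.image_eq, hb.injOn.ncard_image, Set.ncard_univ,
    Complex.card_rootsOfUnity]

theorem existsUnique_degree (h : HolSetup p n r ζ a b) (c : Irr G) :
    ∃! k : Fin (n + 1), c.HasDegree (p ^ (k : ℕ)).totient := by
  obtain ⟨k, hk, ω, R, hR, -, rfl⟩ := h.exists_shiftRep_of_irr c
  refine ⟨⟨k, by omega⟩, ⟨R, hR, rfl⟩, fun k' hk' => Fin.ext ?_⟩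
  exact totient_prime_pow_injective h.prime h.odd (Irr.hasDegree_mk_iff.1 hk')

theorem card_irr (h : HolSetup p n r ζ a b) :
    Nat.card (Irr G) = ∑ k ∈ Finset.range (n + 1), shiftExponent p n k := by
  choose f hf hfu using h.existsUnique_degree
  have hcard : ∀ k : Fin (n + 1), Nat.card {c : Irr G // f c = k} = shiftExponent p n k := by
    intro k
    rw [← h.ncard_hasDegree (k := k) (by omega), ← Nat.card_coe_set_eq]
    refine Nat.card_congr (Equiv.subtypeEquivRight fun c => ⟨?_, fun hc => (hfu c k hc).symm⟩)
    rintro rfl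
    exact hf c
  have hfin : ∀ k : Fin (n + 1), Finite {c : Irr G // f c = k} := fun k =>
    Nat.finite_of_card_ne_zero (by rw [hcard]; exact (shiftExponent_pos h.prime _).ne')
  rw [← Nat.card_congr (Equiv.sigmaFiberEquiv f), Nat.card_sigma,
    ← Fin.sum_univ_eq_sum_range]
  exact Finset.sum_congr rfl fun k _ => hcard k

/-- The terms with `k ≥ 1` form `1 + p + ⋯ + p ^ (n - 1)`, and the term `k = 0` is `p ^ n - p ^ (n -
1)`. -/
theorem sum_shiftExponent (h : HolSetup p n r ζ a b) :
    ((∑ k ∈ Finset.range (n + 1), shiftExponent p n k : ℕ) : ℤ)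
      = (∑ i ∈ Finset.range (n + 1), (p : ℤ) ^ i) - (p : ℤ) ^ (n - 1) := by
  obtain ⟨n', rfl⟩ := Nat.exists_eq_add_of_le' h.one_le
  have h1 : ∀ k ∈ Finset.range (n' + 1),
      shiftExponent p (n' + 1) (k + 1) = p ^ (n' + 1 - 1 - k) := fun k _ => by
    simp [shiftExponent]
  rw [Finset.sum_range_succ', Finset.sum_congr rfl h1,
    Finset.sum_range_reflect (fun i => p ^ i) (n' + 1), Finset.sum_range_succ _ (n' + 1)]
  have hp1 := h.prime.one_le
  simp only [shiftExponent, if_true, Nat.add_sub_cancel]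
  push_cast [Nat.cast_sub hp1]
  ring

/-- In degree `φ(p ^ k)` the element `a ^ p ^ k` acts trivially, which forces `k = n`. For `k = n`,
the image of the first basis vector under `b ^ i * a ^ z` shows both `i` and `z` modulo `p ^ n`. -/
theorem isFaithful_iff (h : HolSetup p n r ζ a b) (c : Irr G) :
    c.IsFaithful ↔ c.HasDegree (p ^ n).totient := by
  have hM := h.exponent_pos
  have hdeg : (p ^ n).totient = p ^ (n - 1) * (p - 1) :=
    Nat.totient_prime_pow h.prime h.one_le
  have key : ∀ {k : ℕ} {ω : ℂ} {R : Representation ℂ G (Fin (p ^ k).totient → ℂ)},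
      IsShiftRep R a b ζ r (p ^ (n - k)) ω → ∀ z : ℤ, R (a ^ z) (Pi.single ⟨0, h.degree_pos k⟩ 1)
        = (ζ ^ p ^ (n - k)) ^ z • Pi.single ⟨0, h.degree_pos k⟩ 1 := by
    intro k ω R hR z
    refine R.zpow_apply_of_eigenvector (pow_ne_zero _ h.ne_zero) ?_ z
    simpa using hR.a_single ⟨0, h.degree_pos k⟩
  have key2 : ∀ {k : ℕ} (z : ℂ),
      z • (Pi.single ⟨0, h.degree_pos k⟩ 1 : Fin (p ^ k).totient → ℂ)
        = Pi.single ⟨0, h.degree_pos k⟩ 1 → z = 1 := fun z hz => by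
    simpa using congrFun hz ⟨0, h.degree_pos _⟩
  constructor
  · intro hc
    obtain ⟨k, hk, ω, R, hR, hS, rfl⟩ := h.exists_shiftRep_of_irr c
    rw [Irr.isFaithful_mk_iff] at hc
    rw [Irr.hasDegree_mk_iff]
    suffices hkn : k = n by rw [hkn]
    have ha : a ^ p ^ k = 1 := by
      refine hc ?_
      rw [map_one]
      refine LinearMap.pi_ext' fun j => LinearMap.ext_ring ?_
      simp only [LinearMap.comp_apply, LinearMap.single_apply, Module.End.one_apply]
      have h1 := R.zpow_apply_of_eigenvector (zpow_ne_zero _ (pow_ne_zero _ h.ne_zero))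
        (hS.a_single j) ((p ^ k : ℕ) : ℤ)
      rw [← zpow_mul, mul_comm, zpow_mul, zpow_natCast, zpow_natCast,
        (h.weight_root hk).pow_eq_one, one_zpow, one_smul] at h1
      exact h1
    -- A shift representation with `k = n` shows that `a ^ p ^ k = 1` is possible only if `p ^ n ∣ p
    -- ^ k`.
    obtain ⟨ρ, hρ⟩ := h.exists_shiftReps le_rfl
    have h1 := key (hρ 1) ((p ^ k : ℕ) : ℤ)
    rw [zpow_natCast, ha, map_one, Module.End.one_apply] at h1
    have h2 := key2 _ h1.symm
    rw [Nat.sub_self, pow_zero, pow_one, zpow_natCast] at h2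
    exact le_antisymm hk
      ((Nat.pow_dvd_pow_iff_le_right h.prime.one_lt).1 (h.root.dvd_of_pow_eq_one _ h2))
  · intro hc
    obtain ⟨ω, R, hR, hS, rfl⟩ := h.exists_shiftRep_of_hasDegree hc
    rw [Irr.isFaithful_mk_iff, injective_iff_map_eq_one]
    intro g hg
    obtain ⟨i, z, hi, rfl⟩ := h.gens.exists_eq_pow_mul_zpow hM g
    rw [← hdeg] at hi
    have h1 := key hS z
    have h2 := LinearMap.congr_fun hg (Pi.single ⟨0, h.degree_pos n⟩ 1)
    rw [map_mul, Module.End.mul_apply, h1, map_smul, hS.pow_single_zero (h.degree_pos n) i hi,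
      Module.End.one_apply] at h2
    have hi0 : i = 0 := by
      by_contra hi0
      have := congrFun h2 ⟨0, h.degree_pos n⟩
      simp [Fin.ext_iff, Ne.symm hi0] at this
    subst hi0
    have h3 := key2 _ h2
    rw [Nat.sub_self, pow_zero, pow_one, h.root.zpow_eq_one_iff_dvd] at h3
    obtain ⟨q, rfl⟩ := h3
    rw [pow_zero, one_mul, zpow_mul, zpow_natCast, h.gens.pow_a, one_zpow]

theorem dvd_orderOf (h : HolSetup p n r ζ a b) : p ^ n ∣ orderOf a := by
  obtain ⟨ρ, hρ⟩ := h.exists_shiftReps le_rfl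
  have h1 := (ρ 1).zpow_apply_of_eigenvector (zpow_ne_zero _ (pow_ne_zero _ h.ne_zero))
    ((hρ 1).a_single ⟨0, h.degree_pos n⟩) (orderOf a : ℤ)
  rw [zpow_natCast, pow_orderOf_eq_one, map_one] at h1
  have h2 := congrFun h1 ⟨0, h.degree_pos n⟩
  simp only [Module.End.one_apply, Nat.sub_self, pow_zero, zpow_one, pow_one, zpow_natCast,
    Pi.smul_apply, Pi.single_eq_same, smul_eq_mul, mul_one] at h2
  exact h.root.dvd_of_pow_eq_one _ h2.symm

theorem exists_characters (h : HolSetup p n r ζ a b) :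
    ∃ χ : ℕ → (Subgroup.zpowers a →* ℂˣ),
      ∀ i : ℕ, ((χ i ⟨a, Subgroup.mem_zpowers a⟩ : ℂˣ) : ℂ) = ζ ^ i := by
  suffices H : ∀ i : ℕ, ∃ χ : Subgroup.zpowers a →* ℂˣ,
      ((χ ⟨a, Subgroup.mem_zpowers a⟩ : ℂˣ) : ℂ) = ζ ^ i from
    ⟨fun i => (H i).choose, fun i => (H i).choose_spec⟩
  intro i
  have hg : ∀ x : Subgroup.zpowers a, x ∈ Subgroup.zpowers (⟨a, Subgroup.mem_zpowers a⟩ :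
      Subgroup.zpowers a) := by
    rintro ⟨_, z, rfl⟩
    exact ⟨z, rfl⟩
  have hdvd : orderOf (Units.mk0 ζ h.ne_zero ^ i) ∣
      orderOf (⟨a, Subgroup.mem_zpowers a⟩ : Subgroup.zpowers a) := by
    rw [Subgroup.orderOf_mk]
    refine (orderOf_dvd_of_pow_eq_one ?_).trans h.dvd_orderOf
    rw [← pow_mul, mul_comm, pow_mul]
    have : Units.mk0 ζ h.ne_zero ^ p ^ n = 1 := Units.ext (by simpa using h.root.pow_eq_one)
    rw [this, one_pow]
  refine ⟨monoidHomOfForallMemZpowers hg hdvd, ?_⟩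
  rw [monoidHomOfForallMemZpowers_apply_gen]
  simp

end HolSetup

/-! ### The correspondence with orbits of characters -/

namespace HolSetup

variable {G : Type*} [Group G] {p n : ℕ} {r : ℤ} {ζ : ℂ} {a b : G}

open Representation

/-- In the induced space `N` acts on the copy of `τ` at `1` through the conjugate of `χ` by `g`.
Translating by `g⁻¹` gives an eigenvector of `a` for the value of `χ` itself, and this eigenvalue
determines the degree. -/
theorem hasDegree_of_corresponds (h : HolSetup p n r ζ a b) [(Subgroup.zpowers a).Normal]
    {k : ℕ} (hk : k ≤ n) {χ : Subgroup.zpowers a →* ℂˣ}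
    (hχ : ((χ ⟨a, Subgroup.mem_zpowers a⟩ : ℂˣ) : ℂ) = ζ ^ p ^ (n - k)) {H : Subgroup G}
    {c : Irr G} (hc : c.Corresponds H (charOrbit χ)) : c.HasDegree (p ^ k).totient := by
  obtain ⟨_, ⟨g, rfl⟩, d, τ, hτ, -, m, R, hR, rfl, ⟨e⟩⟩ := hc
  let I := inertiaGroup (conjChar χ g)
  have hmk : ∀ (x : Subgroup.zpowers a) (v : Fin d → ℂ),
      ind I.subtype τ (x : G) (IndV.mk I.subtype τ 1 v)
        = ((conjChar χ g x : ℂˣ) : ℂ) • IndV.mk I.subtype τ 1 v := by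
    intro x v
    have h1 := ind_apply_mk_one τ ⟨x, le_inertiaGroup _ x.2⟩ v
    rw [hτ _ x.2, LinearMap.smul_apply, map_smul] at h1
    exact h1
  -- Otherwise the zero subrepresentation would be everything, although `R` is nonzero.
  obtain ⟨v, hv⟩ : ∃ v, IndV.mk I.subtype τ 1 v ≠ 0 := by
    by_contra! hall
    have htop := ind_eq_top_of_mk_one_mem τ ⊥ fun v => by
      rw [hall v]; exact Submodule.zero_mem _
    have hbot : (⊤ : Submodule ℂ (IndV I.subtype τ)) = ⊥ := htop.symm
    have := hR.nontrivial
    have : Nontrivial (IndV I.subtype τ) := e.toLinearEquiv.symm.toEquiv.nontrivial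
    exact top_ne_bot hbot
  let w := ind I.subtype τ g⁻¹ (IndV.mk I.subtype τ 1 v)
  have hw : w ≠ 0 := fun e0 => hv (by
    have := congrArg (ind I.subtype τ g) e0
    rwa [Representation.self_inv_apply, map_zero] at this)
  have haw : ind I.subtype τ a w = ζ ^ p ^ (n - k) • w := by
    have h1 := hmk (MulAut.conjNormal g ⟨a, Subgroup.mem_zpowers a⟩) v
    rw [conjChar_apply_conj, hχ, MulAut.conjNormal_apply] at h1
    have h2 : a * g⁻¹ = g⁻¹ * (g * a * g⁻¹) := by group
    change ind I.subtype τ a (ind I.subtype τ g⁻¹ _) = _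
    rw [← Module.End.mul_apply, ← map_mul, h2, map_mul, Module.End.mul_apply, h1, map_smul]
  have hu : e.symm w ≠ 0 := fun e0 => hw (e.symm.toLinearEquiv.map_eq_zero_iff.1 e0)
  have hau : R a (e.symm w) = ζ ^ p ^ (n - k) • e.symm w := by
    have h1 := e.symm.toIntertwiningMap.isIntertwining _ _ a w
    rw [haw, map_smul] at h1
    exact h1.symm
  obtain ⟨ω, hω⟩ := h.exists_equiv_of_eigenvector hk hR hu hau
  obtain ⟨ρ, hρ⟩ := h.exists_shiftReps hk
  obtain ⟨f⟩ := hω _ (hρ ω)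
  exact Irr.hasDegree_mk_iff.2 (degree_eq_of_equiv f)

/-- The stabiliser acts on the line of the first basis vector by a character `τ`, and the universal
property gives a map to the representation induced from `τ`. It is injective by irreducibility of
`R` and surjective because its range contains the generating copy of `τ`. -/
theorem corresponds_of_isShiftRep (h : HolSetup p n r ζ a b) [(Subgroup.zpowers a).Normal]
    {k : ℕ} (hk : k ≤ n) {χ : Subgroup.zpowers a →* ℂˣ}
    (hχ : ((χ ⟨a, Subgroup.mem_zpowers a⟩ : ℂˣ) : ℂ) = ζ ^ p ^ (n - k)) (H : Subgroup G) {ω : ℂ}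
    {R : Representation ℂ G (Fin (p ^ k).totient → ℂ)} (hR : R.IsIrreducible)
    (hS : IsShiftRep R a b ζ r (p ^ (n - k)) ω) :
    (Irr.mk R hR).Corresponds H (charOrbit χ) := by
  have hd := h.degree_pos k
  have hμ0 : ζ ^ p ^ (n - k) ≠ 0 := pow_ne_zero _ h.ne_zero
  set e₀ : Fin (p ^ k).totient → ℂ := Pi.single ⟨0, hd⟩ 1 with he₀
  have he₀0 : e₀ ⟨0, hd⟩ = 1 := by simp [he₀]
  have hae : R a e₀ = ζ ^ p ^ (n - k) • e₀ := by simpa using hS.a_single ⟨0, hd⟩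
  have hχz : ∀ x : Subgroup.zpowers a, R (x : G) e₀ = ((χ x : ℂˣ) : ℂ) • e₀ := by
    rintro ⟨_, z, rfl⟩
    have h1 : (⟨a ^ z, z, rfl⟩ : Subgroup.zpowers a) = ⟨a, Subgroup.mem_zpowers a⟩ ^ z := rfl
    have h2 := R.zpow_apply_of_eigenvector hμ0 hae z
    change R (a ^ z) e₀ = ((χ ⟨a ^ z, z, rfl⟩ : ℂˣ) : ℂ) • e₀
    rw [h2, h1, map_zpow χ, Units.val_zpow_eq_zpow_val, hχ]
  let I := inertiaGroup χ
  -- An element of `I` preserves the `ζ ^ p ^ (n - k)`-eigenspace of `a`, which is a line because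
  -- the weights are distinct.
  have hline : ∀ g : I, R (g : G) e₀ = R (g : G) e₀ ⟨0, hd⟩ • e₀ := by
    intro g
    have hg : conjChar χ (g : G) = χ := g.2
    have h1 := hχz (MulAut.conjNormal (g : G)⁻¹ ⟨a, Subgroup.mem_zpowers a⟩)
    have h2 : χ (MulAut.conjNormal (g : G)⁻¹ ⟨a, Subgroup.mem_zpowers a⟩)
        = χ ⟨a, Subgroup.mem_zpowers a⟩ := DFunLike.congr_fun hg _
    rw [h2, hχ, MulAut.conjNormal_apply, inv_inv] at h1
    have h3 : R a (R (g : G) e₀) = ζ ^ p ^ (n - k) • R (g : G) e₀ := by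
      have h4 : a * (g : G) = g * ((g : G)⁻¹ * a * g) := by group
      rw [← Module.End.mul_apply, ← map_mul, h4, map_mul, Module.End.mul_apply, h1, map_smul]
    ext i
    by_cases hi : i = ⟨0, hd⟩
    · subst hi; simp [he₀0]
    · have h5 := congrFun h3 i
      rw [hS.a_apply, Pi.smul_apply, smul_eq_mul] at h5
      have h6 : R (g : G) e₀ i = 0 := by
        by_contra h6
        have h7 := mul_right_cancel₀ h6 h5
        exact hi (Fin.ext (h.weight_injective hk i 0 i.2 hd (by simpa using h7)))
      have h7 : e₀ i = 0 := by simp [he₀, hi]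
      rw [h6, Pi.smul_apply, h7, smul_zero]
  let τ : Representation ℂ I (Fin 1 → ℂ) :=
    { toFun := fun g => (R (g : G) e₀ ⟨0, hd⟩) • LinearMap.id
      map_one' := by
        simp only [OneMemClass.coe_one, map_one, Module.End.one_apply, he₀0, one_smul]; rfl
      map_mul' := fun g g' => by
        have h1 : R ((g * g' : I) : G) e₀ ⟨0, hd⟩ = R (g : G) e₀ ⟨0, hd⟩ * R (g' : G) e₀ ⟨0, hd⟩ := by
          rw [Subgroup.coe_mul, map_mul, Module.End.mul_apply, hline g', map_smul, Pi.smul_apply,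
            smul_eq_mul, Pi.smul_apply, he₀0, smul_eq_mul, mul_one, mul_comm]
        rw [h1, mul_smul]
        rfl }
  have hτ : ∀ g : I, τ g = (R (g : G) e₀ ⟨0, hd⟩) • LinearMap.id := fun g => rfl
  have hτN : ∀ (g : I) (hg : (g : G) ∈ Subgroup.zpowers a),
      τ g = ((χ ⟨g, hg⟩ : ℂˣ) : ℂ) • LinearMap.id := fun g hg => by
    rw [hτ, hχz ⟨g, hg⟩, Pi.smul_apply, he₀0, smul_eq_mul, mul_one]
  refine ⟨χ, ⟨1, conjChar_one χ⟩, 1, τ, hτN,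
    isIrreducible_of_finrank_eq_one _ (by simp), _, R, hR, rfl, ?_⟩
  have hbI : b ^ (p ^ k).totient ∈ I := by
    change conjChar χ _ = χ
    have h1 : (b ^ (p ^ k).totient)⁻¹ * a * b ^ (p ^ k).totient = a ^ (r ^ (p ^ k).totient) :=
      conj_pow_eq_zpow_pow h.gens.conj _
    have h2 : MulAut.conjNormal (b ^ (p ^ k).totient)⁻¹ (⟨a, Subgroup.mem_zpowers a⟩ :
        Subgroup.zpowers a) = ⟨a, Subgroup.mem_zpowers a⟩ ^ (r ^ (p ^ k).totient) :=
      Subtype.ext (by rw [MulAut.conjNormal_apply, inv_inv, h1]; rfl)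
    have h3 : conjChar χ (b ^ (p ^ k).totient) ⟨a, Subgroup.mem_zpowers a⟩
        = χ ⟨a, Subgroup.mem_zpowers a⟩ := by
      change χ (MulAut.conjNormal (b ^ (p ^ k).totient)⁻¹ ⟨a, Subgroup.mem_zpowers a⟩) = _
      rw [h2, map_zpow]
      refine Units.ext ?_
      rw [Units.val_zpow_eq_zpow_val, hχ, h.weight_periodic hk]
    refine MonoidHom.ext ?_
    rintro ⟨_, z, rfl⟩
    have h4 : (⟨a ^ z, z, rfl⟩ : Subgroup.zpowers a) = ⟨a, Subgroup.mem_zpowers a⟩ ^ z := rfl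
    change conjChar χ _ ⟨a ^ z, z, rfl⟩ = χ ⟨a ^ z, z, rfl⟩
    rw [h4, map_zpow, map_zpow, h3]
  set v := IndV.mk I.subtype τ 1 1 with hv
  have haI : a ∈ I := le_inertiaGroup χ (Subgroup.mem_zpowers a)
  have hav : ind I.subtype τ a v = ζ ^ p ^ (n - k) • v := by
    have h1 := ind_apply_mk_one τ ⟨a, haI⟩ 1
    rw [hτN _ (Subgroup.mem_zpowers a), hχ, LinearMap.smul_apply, map_smul] at h1
    exact h1
  have hbv : ind I.subtype τ (b ^ (p ^ k).totient) v = ω • v := by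
    have h1 := ind_apply_mk_one τ ⟨_, hbI⟩ 1
    rw [hτ, LinearMap.smul_apply, map_smul] at h1
    change _ = (R (b ^ (p ^ k).totient) e₀ ⟨0, hd⟩) • v at h1
    rw [hS.pow_degree hd, LinearMap.smul_apply, Pi.smul_apply, Module.End.one_apply, he₀0,
      smul_eq_mul, mul_one] at h1
    exact h1
  -- The inclusion of the line into `R` lifts to the induced space and sends `v` to `e₀`.
  have hv0 : v ≠ 0 := by
    obtain ⟨Ψ, hΨ⟩ := exists_ind_lift τ R
      ((LinearMap.toSpanSingleton ℂ _ e₀).comp (LinearMap.proj (0 : Fin 1))) (fun g x => by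
        rw [hτ]
        simp only [LinearMap.smul_apply, LinearMap.id_apply, map_smul, LinearMap.comp_apply,
          LinearMap.proj_apply, LinearMap.toSpanSingleton_apply]
        conv_rhs => rw [hline g]
        rw [smul_comm])
    intro hv0
    have h1 := hΨ 1 1
    rw [← hv, hv0, map_zero] at h1
    have h2 := congrFun h1 ⟨0, hd⟩
    simp [he₀0] at h2
  obtain ⟨Φ, hΦ⟩ := hS.exists_intertwiningMap hd h.gens.conj h.gens.closure h.ne_zero _ hav hbv
  have hinj : Function.Injective Φ := by
    rcases IsIrreducible.injective_or_eq_zero Φ with hi | h0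
    · exact hi
    · rw [h0] at hΦ
      exact absurd hΦ.symm hv0
  have hsurj : Function.Surjective Φ := by
    have htop := ind_eq_top_of_mk_one_mem τ Φ.range fun x => by
      refine ⟨x 0 • e₀, ?_⟩
      have hx : x = x 0 • (1 : Fin 1 → ℂ) := by
        ext i; fin_cases i; simp
      have h1 : Φ (x 0 • e₀) = x 0 • v := by rw [map_smul, hΦ]
      conv_rhs => rw [hx, map_smul]
      exact h1
    intro y
    have hy : y ∈ Φ.range.toSubmodule := htop ▸ Submodule.mem_top
    exact hy
  exact ⟨Φ.ofBijective ⟨hinj, hsurj⟩⟩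

theorem corresponds_iff_hasDegree (h : HolSetup p n r ζ a b) [(Subgroup.zpowers a).Normal]
    {k : ℕ} (hk : k ≤ n) {χ : Subgroup.zpowers a →* ℂˣ}
    (hχ : ((χ ⟨a, Subgroup.mem_zpowers a⟩ : ℂˣ) : ℂ) = ζ ^ p ^ (n - k)) (H : Subgroup G)
    (c : Irr G) : c.Corresponds H (charOrbit χ) ↔ c.HasDegree (p ^ k).totient := by
  refine ⟨h.hasDegree_of_corresponds hk hχ, fun hc => ?_⟩
  obtain ⟨ω, R, hR, hS, rfl⟩ := h.exists_shiftRep_of_hasDegree hc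
  exact h.corresponds_of_isShiftRep hk hχ H hR hS

end HolSetup

/-! ### Degree one and the final assembly -/

theorem matA_one_of_pow_eq_one {ζ : ℂ} {m : ℕ} (h : ζ ^ m = 1) (r : ℤ) :
    Matrix.toLin' (matA 1 ζ r m) = LinearMap.id := by
  refine LinearMap.pi_ext' fun j => LinearMap.ext_ring ?_
  simp only [LinearMap.comp_apply, LinearMap.single_apply, LinearMap.id_apply]
  rw [matA_single, h, one_zpow, one_smul]

theorem matB_one (ω : ℂ) : Matrix.toLin' (matB 1 ω) = ω • LinearMap.id := by
  have h := matB_pow_degree 1 ω one_pos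
  rwa [pow_one] at h

theorem theorem6p0p1 (p n : ℕ) (hp : p.Prime) (hodd : Odd p) (hn : 1 ≤ n)
    (C : Type*) [CommGroup C] [IsCyclic C] (hC : Nat.card C = p ^ n)
    (r : ℤ) (hr : orderOf (r : ZMod (p ^ n)) = p ^ (n - 1) * (p - 1))
    (ζ : ℂ) (hζ : IsPrimitiveRoot ζ (p ^ n)) :
    -- the presentation of the holomorph
    Nonempty (PresentedGroup (holRels p n r) ≃* Holomorph C) ∧
    ∀ (e : PresentedGroup (holRels p n r) ≃* Holomorph C) (a b : Holomorph C),
      a = e (PresentedGroup.of 0) → b = e (PresentedGroup.of 1) →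
      -- `N = ⟨a⟩` is normal, and `χ i` is its linear character with `a ↦ ζ ^ i`
      ∃ (_ : (Subgroup.zpowers a).Normal) (χ : ℕ → (Subgroup.zpowers a →* ℂˣ)),
        (∀ i : ℕ, ((χ i ⟨a, Subgroup.mem_zpowers a⟩ : ℂˣ) : ℂ) = ζ ^ i) ∧
        -- (1) the representations of degree 1
        (∃ (ρ : rootsOfUnity (p ^ (n - 1) * (p - 1)) ℂ →
              Representation ℂ (Holomorph C) (Fin 1 → ℂ))
            (hρ : ∀ ω, (ρ ω).IsIrreducible),
          (∀ ω, ρ ω a = LinearMap.id ∧ ρ ω b = ((ω : ℂˣ) : ℂ) • LinearMap.id) ∧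
          Set.BijOn (fun ω => Irr.mk (ρ ω) (hρ ω)) Set.univ
            {c : Irr (Holomorph C) | c.HasDegree 1} ∧
          {c : Irr (Holomorph C) | c.HasDegree 1}.ncard = Nat.totient (p ^ n)) ∧
        -- (2) the representations corresponding to the orbit of `χ (p ^ (n - k))`
        (∀ k : ℕ, 1 ≤ k → k ≤ n →
          ∃ (ρ : rootsOfUnity (p ^ (n - k)) ℂ →
              Representation ℂ (Holomorph C) (Fin (Nat.totient (p ^ k)) → ℂ))
            (hρ : ∀ ω, (ρ ω).IsIrreducible),
          (∀ ω, ρ ω a = Matrix.toLin' (matA (Nat.totient (p ^ k)) ζ r (p ^ (n - k))) ∧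
            ρ ω b = Matrix.toLin' (matB (Nat.totient (p ^ k)) ((ω : ℂˣ) : ℂ))) ∧
          Set.BijOn (fun ω => Irr.mk (ρ ω) (hρ ω)) Set.univ
            {c : Irr (Holomorph C) |
              c.Corresponds (Subgroup.zpowers b) (charOrbit (χ (p ^ (n - k))))} ∧
          {c : Irr (Holomorph C) |
            c.Corresponds (Subgroup.zpowers b) (charOrbit (χ (p ^ (n - k))))}.ncard
              = p ^ (n - k) ∧
          (∀ c : Irr (Holomorph C),
            c.Corresponds (Subgroup.zpowers b) (charOrbit (χ (p ^ (n - k)))) ↔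
              c.HasDegree (Nat.totient (p ^ k)))) ∧
        -- (3) the number of irreducible representations
        (Nat.card (Irr (Holomorph C)) : ℤ)
          = (∑ i ∈ Finset.range (n + 1), (p : ℤ) ^ i) - (p : ℤ) ^ (n - 1) ∧
        -- (4) the representation corresponding to the orbit of `χ 1`
        (∃ c₀ : Irr (Holomorph C),
          {c : Irr (Holomorph C) |
            c.Corresponds (Subgroup.zpowers b) (charOrbit (χ 1))} = {c₀} ∧
          c₀.HasDegree (Nat.totient (p ^ n)) ∧
          {c : Irr (Holomorph C) | c.IsFaithful} = {c₀}) := by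
  refine ⟨nonempty_presentedGroup_mulEquiv_holomorph hp hn hC hr, ?_⟩
  rintro e a b ha hb
  have htot : (p ^ n).totient = p ^ (n - 1) * (p - 1) := Nat.totient_prime_pow hp hn
  have h : HolSetup p n r ζ a b :=
    ⟨hp, hodd, hn, hr.trans htot.symm, hζ, by rw [ha, hb]; exact HolGenerators.of_equiv e⟩
  have hN := h.gens.normal h.exponent_pos
  obtain ⟨χ, hχ⟩ := h.exists_characters
  refine ⟨hN, χ, hχ, ?_, fun k hk1 hk => ?_, ?_, ?_⟩
  · obtain ⟨ρ, hρ⟩ := h.exists_shiftReps (Nat.zero_le n)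
    have hirr := fun ω => h.isIrreducible (Nat.zero_le n) (hρ ω)
    have hbij := h.bijOn_hasDegree ρ hρ hirr
    have hcard := h.ncard_hasDegree (Nat.zero_le n)
    have h1 : (p ^ 0).totient = 1 := by simp
    have hE : shiftExponent p n 0 = p ^ (n - 1) * (p - 1) := if_pos rfl
    have hm : ζ ^ p ^ (n - 0) = 1 := hζ.pow_eq_one
    -- The type of `ρ` involves `φ(p ^ 0)` and `shiftExponent p n 0`; it has to be generalised
    -- before these are rewritten.
    revert ρ
    rw [h1] at hcard ⊢
    rw [hE] at hcard ⊢
    intro ρ hρ hirr hbij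
    refine ⟨ρ, hirr, fun ω => ⟨?_, ?_⟩, hbij, hcard.trans htot.symm⟩
    · rw [(hρ ω).map_a, matA_one_of_pow_eq_one hm]
    · rw [(hρ ω).map_b, matB_one]
  · obtain ⟨ρ, hρ⟩ := h.exists_shiftReps hk
    have hirr := fun ω => h.isIrreducible hk (hρ ω)
    have hbij := h.bijOn_hasDegree ρ hρ hirr
    have hcard := h.ncard_hasDegree hk
    have hcorr := h.corresponds_iff_hasDegree hk (hχ _) (Subgroup.zpowers b)
    have hset : {c : Irr (Holomorph C) |
        c.Corresponds (Subgroup.zpowers b) (charOrbit (χ (p ^ (n - k))))}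
          = {c | c.HasDegree (p ^ k).totient} := Set.ext hcorr
    have hE : shiftExponent p n k = p ^ (n - k) := if_neg (by omega)
    revert ρ
    rw [hE] at hcard ⊢
    intro ρ hρ hirr hbij
    refine ⟨ρ, hirr, fun ω => ⟨(hρ ω).map_a, (hρ ω).map_b⟩, ?_, ?_, hcorr⟩
    · rw [hset]; exact hbij
    · rw [hset]; exact hcard
  · rw [h.card_irr, h.sum_shiftExponent]
  -- For `k = n` the only parameter is `ω = 1`, so there is a single class of degree `φ(p ^ n)`.
  · have hcard := h.ncard_hasDegree le_rfl
    have hE : shiftExponent p n n = 1 := by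
      rw [shiftExponent, if_neg (by omega), Nat.sub_self, pow_zero]
    rw [hE, Set.ncard_eq_one] at hcard
    obtain ⟨c₀, hc₀⟩ := hcard
    have hχ1 : ((χ 1 ⟨a, Subgroup.mem_zpowers a⟩ : ℂˣ) : ℂ) = ζ ^ p ^ (n - n) := by
      rw [hχ, Nat.sub_self, pow_zero]
    refine ⟨c₀, ?_, ?_, ?_⟩
    · rw [← hc₀]
      exact Set.ext (h.corresponds_iff_hasDegree le_rfl hχ1 (Subgroup.zpowers b))
    · have : c₀ ∈ ({c₀} : Set (Irr (Holomorph C))) := rfl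
      rwa [← hc₀] at this
    · rw [← hc₀]
      exact Set.ext h.isFaithful_iff
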